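/- Let $c$ be a small category, and write $c\text{-}\mathbf{Set}$ for the category of functors $c\to\mathbf{Set}$. A familial functor $F\colon d\text{-}\mathbf{Set}\to c\text{-}\mathbf{Set}$ is given by a functor $p(1)\colon c\to\mathbf{Set}$ (operations, with $p_C(1)$ its value at $C$) and a functor $p[-]\colon(\int p(1))^{op}\to d\text{-}\mathbf{Set}$ (arities), via $F(X)_C\cong\sum_{I\in p_C(1)}\mathrm{Hom}(p[I],X)$; such data are the bicomodules from $c$ to $d$, composition $\triangleleft$ of bicomodules is composition of functors, and transformations are natural transformations. Let $(m,\eta,\mu)$ be a familial monad on $c\text{-}\mathbf{Set}$, i.e. a cartesian monad whose underlying endofunctor is familial, with operations $M\in m_C(1)$ and arities $m[M]$. Its theory category $\Theta_m$ has as objects the operations $M$ of $m$, and as morphisms $M\to M'$ the morphisms of $m$-algebras $m(m[M])\to m(m[M'])$ between free algebras. Let $L=[m/m\triangleleft_c m]$ be the familial endofunctor of $c\text{-}\mathbf{Set}$ with the same operations as $m$ and with arities $L[M]=m(m(m[M]))$, and let $u\colon m\to L\triangleleft_c m\triangleleft_c m$ be the transformation sending $(M,\,x\colon m[M]\to X)$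 to $(M,\,m(m(x)))$. Then: 1. $(L,u)$ is the left Kan extension of $m$ along $m\triangleleft_c m$ (the right coclosure). Consequently $L$ carries a comonad structure whose counit $L\to c$ corresponds under this universal property to $m\triangleleft\eta\colon m\to m\triangleleft_c m$ and whose comultiplication corresponds to the composite $m\to L\triangleleft_c m\triangleleft_c m\to L\triangleleft_c L\triangleleft_c m\triangleleft_c m\triangleleft_c m\to L\triangleleft_c L\triangleleft_c m\triangleleft_c m$ of two applications of $u$ followed by $\mu$. Hence the carrier polynomial $\sum_{C}\sum_{M\in m_C(1)}y^{L[M]}$ (with $L[M]$ replaced by its set of elements) is a comonoid for the composition of polynomials, with a comonoid homomorphism to $c$ sending $M\in m_C(1)$ to $C$ (the polynomial comonoid of a small category $a$ is $\sum_{x\in\mathrm{ob}\,a}y^{\{\text{morphisms out of }x\}}$ with counit given by identities and comultiplication given by codomains and composition). 2. There is an isomorphism of polynomial comonoids between $[m/m\triangleleft_c m]$ and the polynomial comonoid of the category $\Theta_m^{op}$. It is the identity on objects (operations), and it commutes with the homomorphisms to $c$; here the cofunctor $\Theta_m^{op}\to c$ sends $M\in m_C(1)$ to $C$ and lifts $g\colon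 C\to D$ to the morphism $m(m[g_*M])\to m(m[M])$ induced by $m[g_*M]\to m[M]$. 3. For every small category $a$ and every cofunctor $\varphi\colon a\to c$ (a function on objects with lifts of all morphisms out of $\varphi(x)$ to morphisms out of $x$, respecting codomains, identities and composites), regard $a$ as the familial comonad on $c\text{-}\mathbf{Set}$ given by $a(X)_C=\sum_{x\in a,\ \varphi(x)=C}\mathrm{Hom}(a[x],X)$, where $a[x]$ is the copresheaf of morphisms out of $x$ graded by the image under $\varphi$ of their codomain, with counit $\epsilon$ and comultiplication $\delta$ given by identities and composition in $a$. Then cofunctors $F\colon\Theta_m^{op}\to a$ that commute with the cofunctors to $c$ are in bijection with the natural transformations $\alpha\colon m\to a\triangleleft_c m\triangleleft_c m$ such that for all $X$ $$\epsilon_{m(m(X))}\circ\alpha_X=m(\eta_X),\qquad \delta_{m(m(X))}\circ\alpha_X=a(a(m(\mu_X)))\circ a(\alpha_{m(X)})\circ\alpha_X .$$ The bijection sends $F$ to the composite of $u$ with $\beta\triangleleft m\triangleleft m$, where $\beta\colon L\to a$ is the transformation whose underlying morphism of polynomials is $F$ under the isomorphism of part 2. -/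

import Mathlib

open CategoryTheory Opposite

universe u

namespace CatSharp

lemma type_hom_ext {X Y : Type u} {f g : X ⟶ Y} (h : ∀ x, f x = g x) : f = g :=
  ConcreteCategory.hom_ext _ _ h

/-! ### Polynomials and polynomial comonoids -/

/-- The endofunctor `S ↦ ∑_{I ∈ p(1)} S^{p[I]}` of sets given by a polynomial `p`.  Morphisms of
polynomials are natural transformations between these functors. -/
def polyFunctor (p : PFunctor.{u, u}) : Type u ⥤ Type u where
  obj S := p.Obj S
  map f := ↾(p.map f)

/-- The composition product of polynomials is composition of the associated functors. -/
def polyFunctorComp (p q : PFunctor.{u, u}) :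
    polyFunctor (p.comp q) ≅ polyFunctor q ⋙ polyFunctor p where
  hom := { app := fun _ => ↾fun z => ⟨z.1.1, fun i => ⟨z.1.2 i, fun j => z.2 ⟨i, j⟩⟩⟩ }
  inv := { app := fun _ => ↾fun z => ⟨⟨z.1, fun i => (z.2 i).1⟩, fun x => (z.2 x.1).2 x.2⟩ }

/-- A comonoid for the composition product of polynomials. -/
structure PolyComonoid where
  /-- the carrier polynomial -/
  carrier : PFunctor.{u, u}
  /-- the counit `ε : c ⟶ y` -/
  counit : polyFunctor carrier ⟶ 𝟭 (Type u)
  /-- the comultiplication `δ : c ⟶ c ◁ c` -/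
  comult : polyFunctor carrier ⟶ polyFunctor carrier ⋙ polyFunctor carrier
  counit_left : ∀ S, comult.app S ≫ counit.app ((polyFunctor carrier).obj S) = 𝟙 _
  counit_right : ∀ S, comult.app S ≫ (polyFunctor carrier).map (counit.app S) = 𝟙 _
  coassoc : ∀ S, comult.app S ≫ (polyFunctor carrier).map (comult.app S) =
    comult.app S ≫ comult.app ((polyFunctor carrier).obj S)

/-- A homomorphism of polynomial comonoids. -/
@[ext]
structure PolyComonoid.Hom (x y : PolyComonoid.{u}) where
  /-- the underlying morphism of polynomials -/
  hom : polyFunctor x.carrier ⟶ polyFunctor y.carrier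
  hom_counit : ∀ S, hom.app S ≫ y.counit.app S = x.counit.app S
  hom_comult : ∀ S, hom.app S ≫ y.comult.app S =
    x.comult.app S ≫ hom.app ((polyFunctor x.carrier).obj S) ≫
      (polyFunctor y.carrier).map (hom.app S)

instance : Category PolyComonoid.{u} where
  Hom := PolyComonoid.Hom
  id x := ⟨𝟙 _, fun S => by simp, fun S => by simp⟩
  comp {x y z} f g := ⟨f.hom ≫ g.hom,
    fun S => by simp [g.hom_counit, f.hom_counit],
    fun S => by
      have h := f.hom_comult S
      rw [NatTrans.comp_app, Category.assoc, g.hom_comult, reassoc_of% h]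
      simp only [NatTrans.comp_app, Functor.map_comp, Category.assoc]
      rw [g.hom.naturality_assoc]⟩

/-! ### Small categories as polynomial comonoids, and cofunctors -/

/-- The set of all morphisms out of an object. -/
abbrev Out {a : Type u} [SmallCategory a] (x : a) : Type u := Σ y : a, (x ⟶ y)

/-- The polynomial comonoid of a small category `c`: positions are objects, directions at an
object are the morphisms out of it; the counit picks the identities, the comultiplication
encodes codomains and composition. -/
def PolyComonoid.ofCat (c : Type u) [SmallCategory c] : PolyComonoid.{u} where
  carrier := ⟨c, fun x => Out x⟩
  counit := { app := fun S => ↾fun z => z.2 ⟨z.1, 𝟙 z.1⟩ }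
  comult := { app := fun S => ↾fun z =>
    ⟨z.1, fun f => ⟨f.1, fun g => z.2 ⟨g.1, f.2 ≫ g.2⟩⟩⟩ }
  counit_left S := by
    ext ⟨x, k⟩
    change (⟨x, fun g : Out x => k ⟨g.1, 𝟙 x ≫ g.2⟩⟩ : Σ x : c, Out x → S) = ⟨x, k⟩
    simp
  counit_right S := by
    ext ⟨x, k⟩
    change (⟨x, fun f : Out x => k ⟨f.1, f.2 ≫ 𝟙 f.1⟩⟩ : Σ x : c, Out x → S) = ⟨x, k⟩
    simp
  coassoc S := by
    ext ⟨x, k⟩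
    change (⟨x, fun f : Out x => ⟨f.1, fun g : Out f.1 => ⟨g.1, fun h : Out g.1 =>
        k ⟨h.1, f.2 ≫ g.2 ≫ h.2⟩⟩⟩⟩ :
          Σ x : c, Out x → Σ x : c, Out x → Σ x : c, Out x → S) =
      ⟨x, fun f : Out x => ⟨f.1, fun g : Out f.1 => ⟨g.1, fun h : Out g.1 =>
        k ⟨h.1, (f.2 ≫ g.2) ≫ h.2⟩⟩⟩⟩
    simp only [Category.assoc]

/-- A cofunctor `a ⟶ c`: a function on objects, together with a lift of every morphism
`f : φ(x) ⟶ d` of `c` to a morphism out of `x` in `a`, respecting codomains, identities and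
composites. -/
structure Cofunctor (a c : Type u) [SmallCategory a] [SmallCategory c] where
  /-- the function on objects -/
  obj : a → c
  /-- the codomain of the lift -/
  cod : ∀ (x : a) {d : c}, (obj x ⟶ d) → a
  /-- the lift -/
  lift : ∀ (x : a) {d : c} (f : obj x ⟶ d), x ⟶ cod x f
  obj_cod : ∀ (x : a) {d : c} (f : obj x ⟶ d), obj (cod x f) = d
  lift_id : ∀ x : a, (⟨cod x (𝟙 (obj x)), lift x (𝟙 (obj x))⟩ : Out x) = ⟨x, 𝟙 x⟩
  lift_comp : ∀ (x : a) {d e : c} (f : obj x ⟶ d) (g : d ⟶ e),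
    (⟨cod x (f ≫ g), lift x (f ≫ g)⟩ : Out x) =
      ⟨cod (cod x f) (eqToHom (obj_cod x f) ≫ g),
        lift x f ≫ lift (cod x f) (eqToHom (obj_cod x f) ≫ g)⟩

namespace Cofunctor

variable {a c : Type u} [SmallCategory a] [SmallCategory c] (φ : Cofunctor a c)

/-- The comonoid homomorphism given by a cofunctor. -/
def toHom : PolyComonoid.ofCat a ⟶ PolyComonoid.ofCat c where
  hom := { app := fun S => ↾fun z =>
    ⟨φ.obj z.1, fun f => z.2 ⟨φ.cod z.1 f.2, φ.lift z.1 f.2⟩⟩ }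
  hom_counit S := by
    refine type_hom_ext fun (z : Σ x : a, Out x → S) => ?_
    obtain ⟨x, k⟩ := z
    change k ⟨φ.cod x (𝟙 (φ.obj x)), φ.lift x (𝟙 (φ.obj x))⟩ = k ⟨x, 𝟙 x⟩
    rw [φ.lift_id]
  hom_comult S := by
    refine type_hom_ext fun (z : Σ x : a, Out x → S) => ?_
    obtain ⟨x, k⟩ := z
    have key : ∀ (d d' : c) (h : d' = d) (k' : Out d → S),
        (⟨d, k'⟩ : Σ d : c, Out d → S) = ⟨d', fun g => k' ⟨g.1, eqToHom h.symm ≫ g.2⟩⟩ := by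
      rintro d _ rfl k'
      simp
    change (⟨φ.obj x, fun f => ⟨f.1, fun g => k ⟨φ.cod x (f.2 ≫ g.2), φ.lift x (f.2 ≫ g.2)⟩⟩⟩ :
        Σ d : c, Out d → Σ d : c, Out d → S) =
      ⟨φ.obj x, fun f => ⟨φ.obj (φ.cod x f.2), fun g =>
        k ⟨φ.cod (φ.cod x f.2) g.2, φ.lift x f.2 ≫ φ.lift (φ.cod x f.2) g.2⟩⟩⟩
    congr 1
    funext f
    rw [key _ _ (φ.obj_cod x f.2)]
    congr 1
    funext g
    refine congrArg k ((φ.lift_comp x f.2 _).trans ?_)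
    have h : eqToHom (φ.obj_cod x f.2) ≫ eqToHom (φ.obj_cod x f.2).symm ≫ g.2 = g.2 := by simp
    rw [h]

end Cofunctor

/-! ### Familial functors -/

/-- The data of a familial functor from copresheaves on `d` to copresheaves on `c`, that is, of a
bicomodule from `c` to `d`: a copresheaf `p(1)` of operations on `c`, and a functor `p[-]` from
the opposite of its category of elements to copresheaves on `d`. -/
structure Familial (c d : Type u) [SmallCategory c] [SmallCategory d] where
  /-- the copresheaf `p(1)` of operations -/
  ops : c ⥤ Type u
  /-- the arities `p[I]` -/
  arity : ops.Elementsᵒᵖ ⥤ (d ⥤ Type u)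

namespace Familial

variable {c d e : Type u} [SmallCategory c] [SmallCategory d] [SmallCategory e]

section

variable (p : Familial c d)

/-- The arity `p[I]` of an operation `I ∈ p_C(1)`. -/
abbrev ar {C : c} (I : p.ops.obj C) : d ⥤ Type u :=
  p.arity.obj (op (p.ops.elementsMk C I))

/-- The map `p[g_* I] ⟶ p[I]` for `g : C ⟶ C'` and `I ∈ p_C(1)`. -/
abbrev res {C C' : c} (g : C ⟶ C') (I : p.ops.obj C) : p.ar (p.ops.map g I) ⟶ p.ar I :=
  p.arity.map (Quiver.Hom.op (CategoryOfElements.homMk (p.ops.elementsMk C I)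
    (p.ops.elementsMk C' (p.ops.map g I)) g rfl))

lemma elt_ext {X : d ⥤ Type u} {C C' : c} (g : C ⟶ C') {I : p.ops.obj C} (h : p.ar I ⟶ X)
    {J : p.ops.obj C'} (t : p.ops.elementsMk C I ⟶ p.ops.elementsMk C' J) (w : t.1 = g) :
    (⟨p.ops.map g I, p.res g I ≫ h⟩ : Σ J : p.ops.obj C', (p.ar J ⟶ X)) =
      ⟨J, p.arity.map t.op ≫ h⟩ := by
  subst w
  have key : ∀ (g : C ⟶ C') (J : p.ops.obj C') (hg : p.ops.map g I = J),
      (⟨p.ops.map g I, p.res g I ≫ h⟩ : Σ J : p.ops.obj C', (p.ar J ⟶ X)) =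
        ⟨J, p.arity.map (Quiver.Hom.op (CategoryOfElements.homMk (p.ops.elementsMk C I)
          (p.ops.elementsMk C' J) g hg)) ≫ h⟩ := by
    rintro g _ rfl
    rfl
  exact key t.1 J t.2

/-- The familial functor `X ↦ (C ↦ ∑_{I ∈ p_C(1)} Hom(p[I], X))`. -/
def functor : (d ⥤ Type u) ⥤ (c ⥤ Type u) where
  obj X :=
    { obj := fun C => Σ I : p.ops.obj C, (p.ar I ⟶ X)
      map := fun g => ↾fun z => ⟨p.ops.map g z.1, p.res g z.1 ≫ z.2⟩
      map_id := fun C => by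
        refine type_hom_ext fun (z : Σ I : p.ops.obj C, (p.ar I ⟶ X)) => ?_
        obtain ⟨I, h⟩ := z
        refine (p.elt_ext (𝟙 C) h (𝟙 _) rfl).trans ?_
        simp
      map_comp := fun {C C' C''} f g => by
        refine type_hom_ext fun (z : Σ I : p.ops.obj C, (p.ar I ⟶ X)) => ?_
        obtain ⟨I, h⟩ := z
        refine (p.elt_ext (f ≫ g) h (CategoryOfElements.homMk (p.ops.elementsMk C I)
          (p.ops.elementsMk C' (p.ops.map f I)) f rfl ≫
          CategoryOfElements.homMk (p.ops.elementsMk C' (p.ops.map f I))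
          (p.ops.elementsMk C'' (p.ops.map g (p.ops.map f I))) g rfl) rfl).trans ?_
        rw [op_comp, Functor.map_comp, Category.assoc]
        rfl }
  map k := { app := fun C => ↾fun z => ⟨z.1, z.2 ≫ k⟩ }

end

/-! ### The right coclosure -/

/-- The right coclosure `[p/q]` of `p` along a functor `q` (the action `q ◁ -` of a bicomodule
on copresheaves): it has the same operations as `p`, and the arity of `I` is `q(p[I])`. -/
def coclosure (p : Familial c e) (q : (e ⥤ Type u) ⥤ (d ⥤ Type u)) : Familial c d where
  ops := p.ops
  arity := p.arity ⋙ q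

/-- The universal transformation `p ⟶ [p/q] ◁ q`. -/
def coclosureUnit (p : Familial c e) (q : (e ⥤ Type u) ⥤ (d ⥤ Type u)) :
    p.functor ⟶ q ⋙ (p.coclosure q).functor where
  app X := { app := fun C => ↾fun z => ⟨z.1, q.map z.2⟩
             naturality := fun C C' g => by
              ext ⟨I, h⟩
              change (⟨p.ops.map g I, q.map (p.res g I ≫ h)⟩ :
                Σ J : p.ops.obj C', (q.obj (p.ar J) ⟶ q.obj X)) =
                ⟨p.ops.map g I, q.map (p.res g I) ≫ q.map h⟩
              rw [q.map_comp] }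
  naturality X Y k := by
    ext C ⟨I, h⟩
    change (⟨I, q.map (h ≫ k)⟩ : Σ J : p.ops.obj C, (q.obj (p.ar J) ⟶ q.obj Y)) =
      ⟨I, q.map h ≫ q.map k⟩
    rw [q.map_comp]

/-- `[p/q]` is the left Kan extension of `p` along `q`. -/
instance isLeftKanExtension_coclosure (p : Familial c e)
    (q : (e ⥤ Type u) ⥤ (d ⥤ Type u)) :
    (p.coclosure q).functor.IsLeftKanExtension (p.coclosureUnit q) := by
  have nat : ∀ {G : (d ⥤ Type u) ⥤ (c ⥤ Type u)} (β : p.functor ⟶ q ⋙ G)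
      {X Y : e ⥤ Type u} (k : X ⟶ Y) {C : c} (z : (p.functor.obj X).obj C),
      (β.app Y).app C ((p.functor.map k).app C z) =
        (G.map (q.map k)).app C ((β.app X).app C z) := by
    intro G β X Y k C z
    exact ConcreteCategory.congr_hom (NatTrans.congr_app (β.naturality k) C) z
  let desc (G : (d ⥤ Type u) ⥤ (c ⥤ Type u)) (β : p.functor ⟶ q ⋙ G) :
      (p.coclosure q).functor ⟶ G :=
    { app := fun X =>
        { app := fun C => ↾fun z => (G.map z.2).app C ((β.app (p.ar z.1)).app C ⟨z.1, 𝟙 _⟩)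
          naturality := fun C C' g => by
            refine type_hom_ext fun
              (z : Σ I : p.ops.obj C, (q.obj (p.ar I) ⟶ X)) => ?_
            obtain ⟨I, h⟩ := z
            have h1 : (β.app (p.ar I)).app C' ⟨p.ops.map g I, p.res g I ≫ 𝟙 _⟩ =
                (G.obj (q.obj (p.ar I))).map g ((β.app (p.ar I)).app C ⟨I, 𝟙 _⟩) :=
              ConcreteCategory.congr_hom ((β.app (p.ar I)).naturality g) ⟨I, 𝟙 _⟩
            have h2 : (β.app (p.ar I)).app C' ⟨p.ops.map g I, 𝟙 _ ≫ p.res g I⟩ =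
                (G.map (q.map (p.res g I))).app C'
                  ((β.app (p.ar (p.ops.map g I))).app C' ⟨p.ops.map g I, 𝟙 _⟩) :=
              nat β (p.res g I) ⟨p.ops.map g I, 𝟙 _⟩
            have h3 := ConcreteCategory.congr_hom ((G.map h).naturality g)
              ((β.app (p.ar I)).app C ⟨I, 𝟙 _⟩)
            rw [Category.comp_id] at h1
            rw [Category.id_comp] at h2
            change (G.map (q.map (p.res g I) ≫ h)).app C'
                ((β.app (p.ar (p.ops.map g I))).app C' ⟨p.ops.map g I, 𝟙 _⟩) =
              (G.obj X).map g ((G.map h).app C ((β.app (p.ar I)).app C ⟨I, 𝟙 _⟩))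
            refine Eq.trans ?_ h3
            change _ = (G.map h).app C'
              ((G.obj (q.obj (p.ar I))).map g ((β.app (p.ar I)).app C ⟨I, 𝟙 _⟩))
            rw [← h1, h2, G.map_comp]
            rfl }
      naturality := fun X Y k => by
        refine NatTrans.ext (funext fun C => type_hom_ext fun
          (z : Σ I : p.ops.obj C, (q.obj (p.ar I) ⟶ X)) => ?_)
        obtain ⟨I, h⟩ := z
        change (G.map (h ≫ k)).app C ((β.app (p.ar I)).app C ⟨I, 𝟙 _⟩) =
          (G.map k).app C ((G.map h).app C ((β.app (p.ar I)).app C ⟨I, 𝟙 _⟩))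
        rw [G.map_comp]
        rfl }
  refine ⟨⟨Limits.IsInitial.ofUniqueHom
    (fun G => StructuredArrow.homMk (desc G.right G.hom) ?_) fun G m => ?_⟩⟩
  · refine NatTrans.ext (funext fun X => NatTrans.ext (funext fun C => type_hom_ext fun
      (z : Σ I : p.ops.obj C, (p.ar I ⟶ X)) => ?_))
    obtain ⟨I, h⟩ := z
    have := nat (G := G.right) G.hom h ⟨I, 𝟙 _⟩
    refine this.symm.trans ?_
    change (G.hom.app X).app C ⟨I, 𝟙 _ ≫ h⟩ = _
    rw [Category.id_comp]
  · ext1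
    refine NatTrans.ext (funext fun X => NatTrans.ext (funext fun C => type_hom_ext fun
      (z : Σ I : p.ops.obj C, (q.obj (p.ar I) ⟶ X)) => ?_))
    obtain ⟨I, h⟩ := z
    have h1 : (m.right.app (q.obj (p.ar I))).app C ⟨I, q.map (𝟙 (p.ar I))⟩ =
        (G.hom.app (p.ar I)).app C ⟨I, 𝟙 _⟩ :=
      ConcreteCategory.congr_hom (NatTrans.congr_app (NatTrans.congr_app
        (StructuredArrow.w m) (p.ar I)) C)
        (⟨I, 𝟙 (p.ar I)⟩ : Σ J : p.ops.obj C, (p.ar J ⟶ p.ar I))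
    have h2 := ConcreteCategory.congr_hom (NatTrans.congr_app (m.right.naturality h) C)
      (⟨I, 𝟙 (q.obj (p.ar I))⟩ : Σ J : p.ops.obj C, (q.obj (p.ar J) ⟶ q.obj (p.ar I)))
    change (m.right.app X).app C ⟨I, 𝟙 (q.obj (p.ar I)) ≫ h⟩ =
        (G.right.map h).app C
          ((m.right.app (q.obj (p.ar I))).app C ⟨I, 𝟙 (q.obj (p.ar I))⟩) at h2
    have e1 : q.map (𝟙 (p.ar I)) = 𝟙 (q.obj (p.ar I)) := q.map_id _
    have e2 : 𝟙 (q.obj (p.ar I)) ≫ h = h := Category.id_comp _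
    exact (congrArg (fun k => (m.right.app X).app C
        (⟨I, k⟩ : Σ J : p.ops.obj C, (q.obj (p.ar J) ⟶ X))) e2.symm).trans
      (h2.trans (congrArg ((G.right.map h).app C)
        ((congrArg (fun k => (m.right.app (q.obj (p.ar I))).app C
          (⟨I, k⟩ : Σ J : p.ops.obj C, (q.obj (p.ar J) ⟶ q.obj (p.ar I)))) e1.symm).trans h1)))

/-! ### Carriers -/

/-- The carrier polynomial `∑_C ∑_{I ∈ p_C(1)} y^{p[I]}` of a bicomodule; its directions at `I`
are all elements of the copresheaf `p[I]`. -/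
def carrier (p : Familial c d) : PFunctor.{u, u} :=
  ⟨Σ C : c, p.ops.obj C, fun I => Σ D : d, (p.ar I.2).obj D⟩

/-- The element of the carrier polynomial underlying an element of `p(X)`, given a function out of
the set of all elements of `X`. -/
def eval (p : Familial c d) {X : d ⥤ Type u} {S : Type u} (k : (Σ D : d, X.obj D) → S)
    (w : Σ C : c, (p.functor.obj X).obj C) : (polyFunctor p.carrier).obj S :=
  ⟨⟨w.1, w.2.1⟩, fun i => k ⟨i.1, w.2.2.app i.1 i.2⟩⟩

/-- The morphism of carrier polynomials underlying a transformation. -/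
def carrierMap {p q : Familial c d} (β : p.functor ⟶ q.functor) :
    polyFunctor p.carrier ⟶ polyFunctor q.carrier where
  app S := ↾fun z => q.eval z.2 ⟨z.1.1, (β.app (p.ar z.1.2)).app z.1.1 ⟨z.1.2, 𝟙 _⟩⟩

end Familial

/-! ### Familial comonads -/

/-- A familial comonad on copresheaves on `c`, that is, a comonad on `c` in the bicategory of
bicomodules. -/
structure FamilialComonad (c : Type u) [SmallCategory c] extends Familial c c where
  /-- the counit -/
  counit : toFamilial.functor ⟶ 𝟭 (c ⥤ Type u)
  /-- the comultiplication -/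
  comult : toFamilial.functor ⟶ toFamilial.functor ⋙ toFamilial.functor
  counit_left : ∀ X, comult.app X ≫ counit.app (toFamilial.functor.obj X) = 𝟙 _
  counit_right : ∀ X, comult.app X ≫ toFamilial.functor.map (counit.app X) = 𝟙 _
  coassoc : ∀ X, comult.app X ≫ toFamilial.functor.map (comult.app X) =
    comult.app X ≫ comult.app (toFamilial.functor.obj X)

namespace FamilialComonad

variable {c : Type u} [SmallCategory c] (E : FamilialComonad c)

/-- The counit at the universal element of an operation `I`: the identity direction at `I`. -/
def idDir {C : c} (I : E.ops.obj C) : (E.ar I).obj C :=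
  (E.counit.app (E.ar I)).app C ⟨I, 𝟙 _⟩

/-- The comultiplication at the universal element of an operation `I`. -/
def split {C : c} (I : E.ops.obj C) :
    (E.functor.obj (E.functor.obj (E.ar I))).obj C :=
  (E.comult.app (E.ar I)).app C ⟨I, 𝟙 _⟩

lemma counit_apply {X : c ⥤ Type u} {C : c} (I : E.ops.obj C) (h : E.ar I ⟶ X) :
    (E.counit.app X).app C ⟨I, h⟩ = h.app C (E.idDir I) := by
  have h1 : (E.counit.app X).app C ⟨I, 𝟙 _ ≫ h⟩ = h.app C (E.idDir I) :=
    ConcreteCategory.congr_hom (NatTrans.congr_app (E.counit.naturality h) C)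
      (⟨I, 𝟙 _⟩ : Σ J : E.ops.obj C, (E.ar J ⟶ E.ar I))
  rwa [Category.id_comp] at h1

lemma comult_apply {X : c ⥤ Type u} {C : c} (I : E.ops.obj C) (h : E.ar I ⟶ X) :
    (E.comult.app X).app C ⟨I, h⟩ = (E.functor.map (E.functor.map h)).app C (E.split I) := by
  have h1 : (E.comult.app X).app C ⟨I, 𝟙 _ ≫ h⟩ =
      (E.functor.map (E.functor.map h)).app C (E.split I) :=
    ConcreteCategory.congr_hom (NatTrans.congr_app (E.comult.naturality h) C)
      (⟨I, 𝟙 _⟩ : Σ J : E.ops.obj C, (E.ar J ⟶ E.ar I))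
  rwa [Category.id_comp] at h1

/-- The counit as a function between sets of all elements. -/
def counitAt (X : c ⥤ Type u) (w : Σ C : c, (E.functor.obj X).obj C) : Σ C : c, X.obj C :=
  ⟨w.1, (E.counit.app X).app w.1 w.2⟩

/-- The counit of the carrier polynomial. -/
def carrierCounit : polyFunctor E.carrier ⟶ 𝟭 (Type u) where
  app S := ↾fun z => z.2 ⟨z.1.1, E.idDir z.1.2⟩

/-- The comultiplication of the carrier polynomial. -/
def carrierComult :
    polyFunctor E.carrier ⟶ polyFunctor E.carrier ⋙ polyFunctor E.carrier where
  app S := ↾fun z => E.eval (E.eval z.2) ⟨z.1.1, E.split z.1.2⟩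

lemma carrierCounit_eval {X : c ⥤ Type u} {S : Type u} (k : (Σ D : c, X.obj D) → S)
    (w : Σ C : c, (E.functor.obj X).obj C) :
    E.carrierCounit.app S (E.eval k w) = k ⟨w.1, (E.counit.app X).app w.1 w.2⟩ := by
  obtain ⟨C, I, h⟩ := w
  rw [counit_apply]
  rfl

lemma carrierComult_eval {X : c ⥤ Type u} {S : Type u} (k : (Σ D : c, X.obj D) → S)
    (w : Σ C : c, (E.functor.obj X).obj C) :
    E.carrierComult.app S (E.eval k w) =
      E.eval (E.eval k) ⟨w.1, (E.comult.app X).app w.1 w.2⟩ := by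
  obtain ⟨C, I, h⟩ := w
  rw [comult_apply]
  rfl

/-- The polynomial comonoid carried by a familial comonad. -/
def comonoid : PolyComonoid.{u} where
  carrier := E.carrier
  counit := E.carrierCounit
  comult := E.carrierComult
  counit_left S := by
    refine type_hom_ext fun (z : (polyFunctor E.carrier).obj S) => ?_
    obtain ⟨⟨C, I⟩, k⟩ := z
    refine (E.carrierCounit_eval (E.eval k) ⟨C, E.split I⟩).trans ?_
    have h : (E.counit.app (E.functor.obj (E.ar I))).app C (E.split I) = ⟨I, 𝟙 _⟩ :=
      ConcreteCategory.congr_hom (NatTrans.congr_app (E.counit_left (E.ar I)) C) _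
    change E.eval k ⟨C, (E.counit.app (E.functor.obj (E.ar I))).app C (E.split I)⟩ = _
    rw [h]
    rfl
  counit_right S := by
    refine type_hom_ext fun (z : (polyFunctor E.carrier).obj S) => ?_
    obtain ⟨⟨C, I⟩, k⟩ := z
    have h : (E.functor.map (E.counit.app (E.ar I))).app C (E.split I) = ⟨I, 𝟙 _⟩ :=
      ConcreteCategory.congr_hom (NatTrans.congr_app (E.counit_right (E.ar I)) C) _
    have h1 : E.eval k ⟨C, (E.functor.map (E.counit.app (E.ar I))).app C (E.split I)⟩ =
        (⟨⟨C, I⟩, k⟩ : (polyFunctor E.carrier).obj S) := by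
      rw [h]
      rfl
    refine Eq.trans ?_ h1
    exact congrArg (fun l => E.eval l ⟨C, E.split I⟩)
      (funext fun w : Σ C : c, (E.functor.obj (E.ar I)).obj C => E.carrierCounit_eval k w)
  coassoc S := by
    refine type_hom_ext fun (z : (polyFunctor E.carrier).obj S) => ?_
    obtain ⟨⟨C, I⟩, k⟩ := z
    have h : (E.functor.map (E.comult.app (E.ar I))).app C (E.split I) =
        (E.comult.app (E.functor.obj (E.ar I))).app C (E.split I) :=
      ConcreteCategory.congr_hom (NatTrans.congr_app (E.coassoc (E.ar I)) C)
        (⟨I, 𝟙 _⟩ : Σ J : E.ops.obj C, (E.ar J ⟶ E.ar I))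
    refine Eq.trans ?_ (E.carrierComult_eval (E.eval k) ⟨C, E.split I⟩).symm
    change _ = E.eval (E.eval (E.eval k)) ⟨C, (E.comult.app (E.functor.obj (E.ar I))).app C (E.split I)⟩
    rw [← h]
    exact congrArg (fun l => E.eval l ⟨C, E.split I⟩)
      (funext fun w : Σ C : c, (E.functor.obj (E.ar I)).obj C => E.carrierComult_eval k w)

/-- The element of the polynomial of `c` given by the orbit of an element of a copresheaf. -/
def orbit {X : c ⥤ Type u} {S : Type u} (k : (Σ D : c, X.obj D) → S)
    (w : Σ C : c, X.obj C) : (polyFunctor (PolyComonoid.ofCat c).carrier).obj S :=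
  ⟨w.1, fun f => k ⟨f.1, X.map f.2 w.2⟩⟩

/-- The homomorphism from the carrier comonoid of a familial comonad on `c` to `c`; it sends the
operations in `e_C(1)` to `C`, and is the morphism of polynomials underlying the counit. -/
def proj : E.comonoid ⟶ PolyComonoid.ofCat c where
  hom := { app := fun S => ↾fun z => orbit z.2 ⟨z.1.1, E.idDir z.1.2⟩ }
  hom_counit S := by
    refine type_hom_ext fun (z : (polyFunctor E.carrier).obj S) => ?_
    obtain ⟨⟨C, I⟩, k⟩ := z
    change k ⟨C, (E.ar I).map (𝟙 C) (E.idDir I)⟩ = k ⟨C, E.idDir I⟩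
    rw [(E.ar I).map_id]
    rfl
  hom_comult S := by
    refine type_hom_ext fun (z : (polyFunctor E.carrier).obj S) => ?_
    obtain ⟨⟨C, I⟩, k⟩ := z
    have key : ∀ {Y : c ⥤ Type u} {R : Type u} (l : (Σ D : c, Y.obj D) → R)
        (w : Σ C : c, (E.functor.obj Y).obj C),
        orbit (E.eval l w).2 ⟨(E.eval l w).1.1, E.idDir (E.eval l w).1.2⟩ =
          orbit l (E.counitAt Y w) := by
      rintro Y R l ⟨C, J, h⟩
      unfold counitAt
      rw [counit_apply]
      change (⟨C, fun f => l ⟨f.1, h.app f.1 ((E.ar J).map f.2 (E.idDir J))⟩⟩ :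
        Σ C : c, Out C → R) = ⟨C, fun f => l ⟨f.1, Y.map f.2 (h.app C (E.idDir J))⟩⟩
      congr 1
      funext f
      rw [NatTrans.naturality_apply]
    have h : (E.counit.app (E.functor.obj (E.ar I))).app C (E.split I) = ⟨I, 𝟙 _⟩ :=
      ConcreteCategory.congr_hom (NatTrans.congr_app (E.counit_left (E.ar I)) C) _
    have hl : (fun w : Σ D : c, (E.functor.obj (E.ar I)).obj D =>
        orbit (E.eval k w).2 ⟨(E.eval k w).1.1, E.idDir (E.eval k w).1.2⟩) =
        fun w => orbit k (E.counitAt (E.ar I) w) :=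
      funext fun w => key k w
    have h1 := key (fun w : Σ D : c, (E.functor.obj (E.ar I)).obj D =>
        orbit (E.eval k w).2 ⟨(E.eval k w).1.1, E.idDir (E.eval k w).1.2⟩) ⟨C, E.split I⟩
    have h2 : orbit (fun w : Σ D : c, (E.functor.obj (E.ar I)).obj D =>
        orbit k (E.counitAt (E.ar I) w)) ⟨C, ⟨I, 𝟙 _⟩⟩ =
        orbit (orbit k) ⟨C, E.idDir I⟩ := by
      have := fun {D : c} (g : C ⟶ D) => NatTrans.naturality_apply
        (E.counit.app (E.ar I)) g (⟨I, 𝟙 _⟩ : Σ J : E.ops.obj C, (E.ar J ⟶ E.ar I))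
      exact congrArg (Sigma.mk C) (funext fun f : Out C => congrArg
        (fun y : (E.ar I).obj f.1 =>
          orbit (X := E.ar I) k ⟨f.1, y⟩) (this f.2))
    have h3 : (PolyComonoid.ofCat c).comult.app S (orbit k ⟨C, E.idDir I⟩) =
        orbit (orbit k) ⟨C, E.idDir I⟩ := by
      change (⟨C, fun f => ⟨f.1, fun g => k ⟨g.1, (E.ar I).map (f.2 ≫ g.2) (E.idDir I)⟩⟩⟩ :
          Σ C : c, Out C → Σ C : c, Out C → S) =
        ⟨C, fun f => ⟨f.1, fun g => k ⟨g.1, (E.ar I).map g.2 ((E.ar I).map f.2 (E.idDir I))⟩⟩⟩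
      simp only [Functor.map_comp_apply]
    refine h3.trans (h2.symm.trans ?_)
    rw [hl] at h1
    change _ = orbit (fun w : Σ D : c, (E.functor.obj (E.ar I)).obj D =>
        orbit k (E.counitAt (E.ar I) w))
        ⟨C, (E.counit.app (E.functor.obj (E.ar I))).app C (E.split I)⟩ at h1
    rw [h] at h1
    refine h1.symm.trans ?_
    rw [← hl]
    rfl

end FamilialComonad

/-! ### The familial comonad of a cofunctor -/

namespace Cofunctor

variable {a c : Type u} [SmallCategory a] [SmallCategory c] (φ : Cofunctor a c)

/-- The lift of `g : C ⟶ D` at an object `x` lying over `C`. -/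
def act (x : a) {C D : c} (hx : φ.obj x = C) (g : C ⟶ D) : Out x :=
  ⟨φ.cod x (eqToHom hx ≫ g), φ.lift x (eqToHom hx ≫ g)⟩

lemma obj_act (x : a) {C D : c} (hx : φ.obj x = C) (g : C ⟶ D) :
    φ.obj (φ.act x hx g).1 = D :=
  φ.obj_cod x _

/-- Composition of a morphism out of `x` with a morphism out of its codomain. -/
def comp {x : a} (f : Out x) (g : Out f.1) : Out x := ⟨g.1, f.2 ≫ g.2⟩

lemma act_rfl (x : a) {D : c} (g : φ.obj x ⟶ D) :
    φ.act x rfl g = ⟨φ.cod x g, φ.lift x g⟩ := by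
  have h : eqToHom (rfl : φ.obj x = φ.obj x) ≫ g = g := Category.id_comp _
  unfold act
  rw [h]

lemma act_id (x : a) {C : c} (hx : φ.obj x = C) : φ.act x hx (𝟙 C) = ⟨x, 𝟙 x⟩ := by
  subst hx
  rw [act_rfl, φ.lift_id]

lemma act_comp (x : a) {C D D' : c} (hx : φ.obj x = C) (f : C ⟶ D) (g : D ⟶ D') :
    φ.act x hx (f ≫ g) = comp (φ.act x hx f) (φ.act _ (φ.obj_act x hx f) g) := by
  subst hx
  have key : ∀ (F : Out x) (hF : F = ⟨φ.cod x f, φ.lift x f⟩) (h : φ.obj F.1 = D),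
      φ.act x rfl (f ≫ g) = comp F (φ.act F.1 h g) := by
    rintro _ rfl h
    rw [act_rfl, φ.lift_comp]
    rfl
  exact key _ (φ.act_rfl x f) _

/-- The copresheaf `a[x]` on `c`: its elements over `D` are the morphisms out of `x` whose
codomain is sent to `D`, and `c` acts by composition with lifts. -/
def outs (x : a) : c ⥤ Type u where
  obj D := {f : Out x // φ.obj f.1 = D}
  map g := ↾fun f => ⟨comp f.1 (φ.act f.1.1 f.2 g), φ.obj_act _ _ _⟩
  map_id D := by
    refine type_hom_ext fun (f : {f : Out x // φ.obj f.1 = D}) => ?_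
    refine Subtype.ext ?_
    change comp f.1 (φ.act f.1.1 f.2 (𝟙 D)) = f.1
    rw [act_id]
    simp [comp]
  map_comp {D D' D''} g g' := by
    refine type_hom_ext fun (f : {f : Out x // φ.obj f.1 = D}) => ?_
    refine Subtype.ext ?_
    change comp f.1 (φ.act f.1.1 f.2 (g ≫ g')) = comp (comp f.1 (φ.act f.1.1 f.2 g))
      (φ.act _ (φ.obj_act _ _ _) g')
    rw [act_comp]
    simp [comp]

/-- Precomposition with a morphism of `a`. -/
def pre {x y : a} (f : x ⟶ y) : φ.outs y ⟶ φ.outs x where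
  app D := ↾fun g => ⟨comp ⟨y, f⟩ g.1, g.2⟩
  naturality D D' r := by
    refine type_hom_ext fun (g : {g : Out y // φ.obj g.1 = D}) => ?_
    refine Subtype.ext ?_
    change comp ⟨y, f⟩ (comp g.1 (φ.act g.1.1 g.2 r)) =
      comp (comp ⟨y, f⟩ g.1) (φ.act g.1.1 g.2 r)
    simp [comp]

lemma pre_id (x : a) : φ.pre (𝟙 x) = 𝟙 _ := by
  refine NatTrans.ext (funext fun D => type_hom_ext fun
    (g : {g : Out x // φ.obj g.1 = D}) => Subtype.ext ?_)
  change comp (⟨x, 𝟙 x⟩ : Out x) g.1 = g.1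
  simp [comp]

lemma pre_comp {x y z : a} (f : x ⟶ y) (g : y ⟶ z) :
    φ.pre (f ≫ g) = φ.pre g ≫ φ.pre f := by
  refine NatTrans.ext (funext fun D => type_hom_ext fun
    (h : {h : Out z // φ.obj h.1 = D}) => Subtype.ext ?_)
  change comp (⟨z, f ≫ g⟩ : Out x) h.1 = comp ⟨y, f⟩ (comp ⟨z, g⟩ h.1)
  simp [comp]

/-- The copresheaf on `c` of objects of `a`, graded by their image in `c`. -/
def objs : c ⥤ Type u where
  obj C := {x : a // φ.obj x = C}
  map g := ↾fun x => ⟨(φ.act x.1 x.2 g).1, φ.obj_act _ _ _⟩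
  map_id C := by
    refine type_hom_ext fun (x : {x : a // φ.obj x = C}) => Subtype.ext ?_
    exact congrArg Sigma.fst (φ.act_id x.1 x.2)
  map_comp {C C' C''} g g' := by
    refine type_hom_ext fun (x : {x : a // φ.obj x = C}) => Subtype.ext ?_
    exact congrArg Sigma.fst (φ.act_comp x.1 x.2 g g')

/-- The lift attached to a morphism of elements of `objs`. -/
def eltHom {s t : φ.objs.Elements} (r : s ⟶ t) : s.2.1 ⟶ t.2.1 :=
  (φ.act s.2.1 s.2.2 r.1).2 ≫ eqToHom (congrArg Subtype.val r.2)

lemma eltHom_eq {s t : φ.objs.Elements} (r : s ⟶ t) :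
    (⟨t.2.1, φ.eltHom r⟩ : Out s.2.1) = φ.act s.2.1 s.2.2 r.1 := by
  have : ∀ {x y : a} (f : Out x) (h : f.1 = y), (⟨y, f.2 ≫ eqToHom h⟩ : Out x) = f := by
    rintro x _ f rfl
    simp
  exact this _ _

lemma eltHom_id (s : φ.objs.Elements) : φ.eltHom (𝟙 s) = 𝟙 _ :=
  eq_of_heq (Sigma.mk.inj ((φ.eltHom_eq (𝟙 s)).trans (φ.act_id _ _))).2

lemma eltHom_comp {s t v : φ.objs.Elements} (r : s ⟶ t) (r' : t ⟶ v) :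
    φ.eltHom (r ≫ r') = φ.eltHom r ≫ φ.eltHom r' := by
  have key : ∀ (F : Out s.2.1) (hF : F = φ.act s.2.1 s.2.2 r.1) (h : φ.obj F.1 = t.1),
      φ.act s.2.1 s.2.2 (r.1 ≫ r'.1) = comp F (φ.act F.1 h r'.1) := by
    rintro _ rfl h
    exact φ.act_comp _ _ _ _
  have h1 := key _ (φ.eltHom_eq r) t.2.2
  rw [← φ.eltHom_eq r'] at h1
  exact eq_of_heq (Sigma.mk.inj ((φ.eltHom_eq (r ≫ r')).trans h1)).2

/-- A cofunctor `a ⟶ c` as a bicomodule from `c` to `c`, that is, the familial functor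
`X ↦ (C ↦ ∑_{x ∈ a, φ(x) = C} Hom(a[x], X))`. -/
def familial : Familial c c where
  ops := φ.objs
  arity :=
    { obj := fun s => φ.outs s.unop.2.1
      map := fun r => φ.pre (φ.eltHom r.unop)
      map_id := fun s => by
        rw [unop_id, φ.eltHom_id, φ.pre_id]
      map_comp := fun r r' => by
        rw [unop_comp, φ.eltHom_comp, φ.pre_comp] }

lemma res_eq {C D : c} (g : C ⟶ D) (x : {x : a // φ.obj x = C}) :
    φ.familial.res g x = φ.pre (φ.act x.1 x.2 g).2 :=
  congrArg φ.pre (Category.comp_id _)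

/-- The identity at `x` as an element of `a[x]`. -/
def unitElt {C : c} (x : {x : a // φ.obj x = C}) : (φ.outs x.1).obj C :=
  ⟨⟨x.1, 𝟙 x.1⟩, x.2⟩

lemma res_unitElt {C D : c} (g : C ⟶ D) (x : {x : a // φ.obj x = C}) :
    (φ.familial.res g x).app D (φ.unitElt (φ.objs.map g x)) =
      (φ.outs x.1).map g (φ.unitElt x) := by
  rw [φ.res_eq]
  refine Subtype.ext ?_
  change comp (φ.act x.1 x.2 g) ⟨_, 𝟙 _⟩ = comp ⟨x.1, 𝟙 x.1⟩ (φ.act x.1 x.2 g)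
  simp [comp]

/-- The map `a[x] ⟶ A(X)` induced by a map `a[x] ⟶ X`, where `A` is the familial functor of the
cofunctor `φ`: it sends `f : x ⟶ y` to `y` together with `a[y] ⟶ a[x] ⟶ X`. -/
def unfold {X : c ⥤ Type u} {x : a} (h : φ.outs x ⟶ X) : φ.outs x ⟶ φ.familial.functor.obj X where
  app D := ↾fun f => ⟨⟨f.1.1, f.2⟩, φ.pre f.1.2 ≫ h⟩
  naturality D D' r := by
    refine type_hom_ext fun (f : {f : Out x // φ.obj f.1 = D}) => ?_
    change (⟨⟨(φ.act f.1.1 f.2 r).1, _⟩, φ.pre (f.1.2 ≫ (φ.act f.1.1 f.2 r).2) ≫ h⟩ :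
        Σ y : {y : a // φ.obj y = D'}, (φ.outs y.1 ⟶ X)) =
      ⟨φ.objs.map r ⟨f.1.1, f.2⟩, φ.familial.res r ⟨f.1.1, f.2⟩ ≫ φ.pre f.1.2 ≫ h⟩
    rw [res_eq, pre_comp, Category.assoc]
    rfl

lemma unfold_pre {X : c ⥤ Type u} {x y : a} (f : x ⟶ y) (h : φ.outs x ⟶ X) :
    φ.unfold (φ.pre f ≫ h) = φ.pre f ≫ φ.unfold h := by
  refine NatTrans.ext (funext fun D => type_hom_ext fun
    (g : {g : Out y // φ.obj g.1 = D}) => ?_)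
  change (⟨⟨g.1.1, g.2⟩, φ.pre g.1.2 ≫ φ.pre f ≫ h⟩ :
    Σ y : {y : a // φ.obj y = D}, (φ.outs y.1 ⟶ X)) = ⟨⟨g.1.1, g.2⟩, φ.pre (f ≫ g.1.2) ≫ h⟩
  rw [pre_comp, Category.assoc]

/-- A cofunctor `a ⟶ c` makes `a` a familial comonad on copresheaves on `c`: the counit evaluates
at the identities of `a`, and the comultiplication is given by composition in `a`. -/
def comonad : FamilialComonad c where
  toFamilial := φ.familial
  counit :=
    { app := fun X =>
        { app := fun C => ↾fun (z : Σ x : {x : a // φ.obj x = C}, (φ.outs x.1 ⟶ X)) =>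
            z.2.app C (φ.unitElt z.1)
          naturality := fun C D g => by
            refine type_hom_ext fun
              (z : Σ x : {x : a // φ.obj x = C}, (φ.outs x.1 ⟶ X)) => ?_
            refine Eq.trans ?_ (NatTrans.naturality_apply z.2 g (φ.unitElt z.1))
            exact congrArg (z.2.app D) (φ.res_unitElt g z.1) }
      naturality := fun X Y k => rfl }
  comult :=
    { app := fun X =>
        { app := fun C => ↾fun (z : Σ x : {x : a // φ.obj x = C}, (φ.outs x.1 ⟶ X)) =>
            ⟨z.1, φ.unfold z.2⟩
          naturality := fun C D g => by
            refine type_hom_ext fun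
              (z : Σ x : {x : a // φ.obj x = C}, (φ.outs x.1 ⟶ X)) => ?_
            exact congrArg (fun k => (⟨φ.objs.map g z.1, k⟩ :
              Σ x : {x : a // φ.obj x = D}, (φ.outs x.1 ⟶ φ.familial.functor.obj X)))
              (φ.unfold_pre _ z.2) }
      naturality := fun X Y k => rfl }
  counit_left X := by
    refine NatTrans.ext (funext fun C => type_hom_ext fun
      (z : Σ x : {x : a // φ.obj x = C}, (φ.outs x.1 ⟶ X)) => ?_)
    change (⟨z.1, φ.pre (𝟙 z.1.1) ≫ z.2⟩ :
      Σ x : {x : a // φ.obj x = C}, (φ.outs x.1 ⟶ X)) = z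
    rw [pre_id, Category.id_comp]
  counit_right X := by
    refine NatTrans.ext (funext fun C => type_hom_ext fun
      (z : Σ x : {x : a // φ.obj x = C}, (φ.outs x.1 ⟶ X)) => ?_)
    obtain ⟨x, h⟩ := z
    refine congrArg (Sigma.mk x) (NatTrans.ext (funext fun D => type_hom_ext fun
      (f : {f : Out x.1 // φ.obj f.1 = D}) => ?_))
    refine congrArg (h.app D) (Subtype.ext ?_)
    change comp ⟨f.1.1, f.1.2⟩ ⟨f.1.1, 𝟙 _⟩ = f.1
    simp [comp]
  coassoc X := by
    refine NatTrans.ext (funext fun C => type_hom_ext fun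
      (z : Σ x : {x : a // φ.obj x = C}, (φ.outs x.1 ⟶ X)) => ?_)
    obtain ⟨x, h⟩ := z
    refine congrArg (Sigma.mk x) (NatTrans.ext (funext fun D => type_hom_ext fun
      (f : {f : Out x.1 // φ.obj f.1 = D}) => ?_))
    exact congrArg (Sigma.mk (⟨f.1.1, f.2⟩ : {y : a // φ.obj y = D})) (φ.unfold_pre f.1.2 h)

/-- The carrier comonoid of the familial comonad of a cofunctor `φ : a ⟶ c` is the comonoid of
`a`: the position `x` over `C` corresponds to `x`, and the directions at `x`, which are the
elements of `a[x]`, correspond to the morphisms out of `x`. -/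
def comonoidIso : φ.comonad.comonoid ≅ PolyComonoid.ofCat a where
  hom :=
    { hom := { app := fun S => ↾fun z => ⟨z.1.2.1, fun f => z.2 ⟨φ.obj f.1, ⟨f, rfl⟩⟩⟩ }
      hom_counit := fun S => by
        refine type_hom_ext fun (z : (polyFunctor φ.familial.carrier).obj S) => ?_
        obtain ⟨⟨_, x, rfl⟩, k⟩ := z
        rfl
      hom_comult := fun S => by
        refine type_hom_ext fun (z : (polyFunctor φ.familial.carrier).obj S) => ?_
        obtain ⟨⟨_, x, rfl⟩, k⟩ := z
        rfl }
  inv :=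
    { hom := { app := fun S => ↾fun z => ⟨⟨φ.obj z.1, ⟨z.1, rfl⟩⟩, fun f => z.2 f.2.1⟩ }
      hom_counit := fun S => rfl
      hom_comult := fun S => by
        refine type_hom_ext fun (z : Σ x : a, Out x → S) => ?_
        obtain ⟨x, k⟩ := z
        refine congrArg (Sigma.mk (⟨φ.obj x, ⟨x, rfl⟩⟩ : Σ C : c, {x : a // φ.obj x = C}))
          (funext fun f : Σ C : c, {f : Out x // φ.obj f.1 = C} => ?_)
        obtain ⟨_, f, rfl⟩ := f
        rfl }
  hom_inv_id := by
    refine PolyComonoid.Hom.ext (NatTrans.ext (funext fun S => type_hom_ext fun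
      (z : (polyFunctor φ.familial.carrier).obj S) => ?_))
    obtain ⟨⟨_, x, rfl⟩, k⟩ := z
    refine congrArg (Sigma.mk (⟨φ.obj x, ⟨x, rfl⟩⟩ : Σ C : c, {x : a // φ.obj x = C}))
      (funext fun f : Σ C : c, {f : Out x // φ.obj f.1 = C} => ?_)
    obtain ⟨_, f, rfl⟩ := f
    rfl
  inv_hom_id := rfl

end Cofunctor

/-! ### Familial monads and theory categories -/

section ComonadLaws

variable {A : Type*} [Category A] {T L : A ⥤ A} {η : ∀ X, X ⟶ T.obj X}
  {μ : ∀ X, T.obj (T.obj X) ⟶ T.obj X} {υ : ∀ X, T.obj X ⟶ L.obj (T.obj (T.obj X))}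
  {ε : ∀ X, L.obj X ⟶ X} {δ : ∀ X, L.obj X ⟶ L.obj (L.obj X)}

lemma comonad_law_left (nυ : ∀ {X Y} (k : X ⟶ Y), T.map k ≫ υ Y = υ X ≫ L.map (T.map (T.map k)))
    (nε : ∀ {X Y} (k : X ⟶ Y), L.map k ≫ ε Y = ε X ≫ k)
    (hε : ∀ X, υ X ≫ ε _ = T.map (η X))
    (hδ : ∀ X, υ X ≫ δ _ = υ X ≫ L.map (υ (T.obj X)) ≫ L.map (L.map (T.map (μ X))))
    (hμ : ∀ X, T.map (η X) ≫ μ X = 𝟙 _) (X : A) : υ X ≫ δ _ ≫ ε _ = υ X := by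
  rw [reassoc_of% hδ, nε, reassoc_of% nε, reassoc_of% hε, reassoc_of% nυ,
    ← Functor.map_comp, ← Functor.map_comp, hμ]
  simp

lemma comonad_law_right (nε : ∀ {X Y} (k : X ⟶ Y), L.map k ≫ ε Y = ε X ≫ k)
    (hε : ∀ X, υ X ≫ ε _ = T.map (η X))
    (hδ : ∀ X, υ X ≫ δ _ = υ X ≫ L.map (υ (T.obj X)) ≫ L.map (L.map (T.map (μ X))))
    (hμ : ∀ X, η (T.obj X) ≫ μ X = 𝟙 _) (X : A) : υ X ≫ δ _ ≫ L.map (ε _) = υ X := by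
  rw [reassoc_of% hδ]
  simp only [← Functor.map_comp]
  rw [nε, reassoc_of% hε, ← Functor.map_comp, hμ]
  simp

lemma comonad_law_assoc
    (nυ : ∀ {X Y} (k : X ⟶ Y), T.map k ≫ υ Y = υ X ≫ L.map (T.map (T.map k)))
    (nδ : ∀ {X Y} (k : X ⟶ Y), L.map k ≫ δ Y = δ X ≫ L.map (L.map k))
    (hδ : ∀ X, υ X ≫ δ _ = υ X ≫ L.map (υ (T.obj X)) ≫ L.map (L.map (T.map (μ X))))
    (hμ : ∀ X, T.map (μ X) ≫ μ X = μ (T.obj X) ≫ μ X) (X : A) :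
    υ X ≫ δ _ ≫ L.map (δ _) = υ X ≫ δ _ ≫ δ _ := by
  have h6 : T.map (T.map (μ X)) ≫ T.map (μ X) = T.map (μ (T.obj X)) ≫ T.map (μ X) := by
    rw [← T.map_comp, hμ, T.map_comp]
  rw [reassoc_of% hδ, reassoc_of% hδ, nδ, reassoc_of% nδ, reassoc_of% hδ]
  simp only [← Functor.map_comp]
  rw [nδ, reassoc_of% hδ, reassoc_of% nυ]
  simp only [← Functor.map_comp, h6]

end ComonadLaws

/-- A familial monad: a cartesian monad on the category of copresheaves on `c` whose underlying
endofunctor is familial.  (Familial functors preserve pullbacks, so cartesianness amounts to the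
naturality squares of the unit and multiplication being pullbacks.) -/
structure FamilialMonad (c : Type u) [SmallCategory c] extends Monad (c ⥤ Type u) where
  /-- the operations and arities -/
  familial : Familial c c
  /-- the identification of the underlying endofunctor with the familial functor -/
  iso : toFunctor ≅ familial.functor
  cartesian_η : NatTrans.Equifibered η
  cartesian_μ : NatTrans.Equifibered μ

namespace FamilialMonad

variable {c : Type u} [SmallCategory c] (m : FamilialMonad c)

/-- The theory category `Θ_m`: its objects are the operations `M ∈ m_C(1)`, and its morphisms are
those of the full subcategory of `m`-algebras spanned by the free algebras `m(m[M])`. -/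
abbrev Theory : Type u :=
  InducedCategory m.toMonad.Algebra
    (fun M : Σ C : c, m.familial.ops.obj C => m.toMonad.free.obj (m.familial.ar M.2))

/-- The morphism `m(m[J]) ⟶ m(m[I])` of `Θ_m` given by a morphism of elements `I ⟶ J`. -/
def inert {s t : m.familial.ops.Elements} (r : s ⟶ t) :
    (show m.Theory from ⟨t.1, t.2⟩) ⟶ (show m.Theory from ⟨s.1, s.2⟩) :=
  InducedCategory.homMk (m.toMonad.free.map (m.familial.arity.map r.op))

lemma inert_id (s : m.familial.ops.Elements) : m.inert (𝟙 s) = 𝟙 _ := by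
  refine InducedCategory.hom_ext ?_
  change m.toMonad.free.map (m.familial.arity.map (𝟙 s).op) = 𝟙 _
  rw [op_id, CategoryTheory.Functor.map_id, CategoryTheory.Functor.map_id]

lemma inert_comp {s t v : m.familial.ops.Elements} (r : s ⟶ t) (r' : t ⟶ v) :
    m.inert (r ≫ r') = m.inert r' ≫ m.inert r := by
  refine InducedCategory.hom_ext ?_
  change m.toMonad.free.map (m.familial.arity.map (r ≫ r').op) =
    m.toMonad.free.map (m.familial.arity.map r'.op) ≫
      m.toMonad.free.map (m.familial.arity.map r.op)
  rw [op_comp, Functor.map_comp, Functor.map_comp]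

lemma inert_ext {C D : c} (g : C ⟶ D) (I : m.familial.ops.obj C) {J : m.familial.ops.obj D}
    (t : m.familial.ops.elementsMk C I ⟶ m.familial.ops.elementsMk D J) (w : t.1 = g) :
    (⟨op ⟨D, m.familial.ops.map g I⟩,
      (m.inert (CategoryOfElements.homMk (m.familial.ops.elementsMk C I)
        (m.familial.ops.elementsMk D (m.familial.ops.map g I)) g rfl)).op⟩ :
          Out (op (show m.Theory from ⟨C, I⟩))) = ⟨op ⟨D, J⟩, (m.inert t).op⟩ := by
  have key : ∀ (g : C ⟶ D) (J : m.familial.ops.obj D) (hg : m.familial.ops.map g I = J),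
      (⟨op ⟨D, m.familial.ops.map g I⟩,
        (m.inert (CategoryOfElements.homMk (m.familial.ops.elementsMk C I)
          (m.familial.ops.elementsMk D (m.familial.ops.map g I)) g rfl)).op⟩ :
            Out (op (show m.Theory from ⟨C, I⟩))) =
      ⟨op ⟨D, J⟩, (m.inert (CategoryOfElements.homMk (m.familial.ops.elementsMk C I)
          (m.familial.ops.elementsMk D J) g hg)).op⟩ := by
    rintro g _ rfl
    rfl
  subst w
  exact key t.1 J t.2

/-- The cofunctor `Θ_mᵒᵖ ⟶ c` sending `M ∈ m_C(1)` to `C`; the lift of `g : C ⟶ D` at `M` is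
the morphism `m(m[g_* M]) ⟶ m(m[M])` induced by `m[g_* M] ⟶ m[M]`. -/
def theoryCofunctor : Cofunctor m.Theoryᵒᵖ c where
  obj M := M.unop.1
  cod M {D} g := op ⟨D, m.familial.ops.map g M.unop.2⟩
  lift M {D} g := (m.inert (CategoryOfElements.homMk
    (m.familial.ops.elementsMk M.unop.1 M.unop.2)
    (m.familial.ops.elementsMk D (m.familial.ops.map g M.unop.2)) g rfl)).op
  obj_cod M D g := rfl
  lift_id M := by
    refine (m.inert_ext (𝟙 M.unop.1) M.unop.2 (𝟙 _) rfl).trans ?_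
    rw [inert_id]
    rfl
  lift_comp M D D' g g' := by
    have h : eqToHom (rfl : D = D) ≫ g' = g' := Category.id_comp _
    rw [h]
    refine (m.inert_ext (g ≫ g') M.unop.2
      (CategoryOfElements.homMk (m.familial.ops.elementsMk M.unop.1 M.unop.2)
        (m.familial.ops.elementsMk D (m.familial.ops.map g M.unop.2)) g rfl ≫
      CategoryOfElements.homMk (m.familial.ops.elementsMk D (m.familial.ops.map g M.unop.2))
        (m.familial.ops.elementsMk D' (m.familial.ops.map g' (m.familial.ops.map g M.unop.2)))
        g' rfl) rfl).trans ?_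
    rw [inert_comp]
    rfl

/-- The right coclosure `[m / m ◁ m]`, with arities `m(m(m[M]))`. -/
def coclosure : Familial c c := m.familial.coclosure (m.toFunctor ⋙ m.toFunctor)

/-- The universal transformation `m ⟶ [m / m ◁ m] ◁ m ◁ m`. -/
def coclosureUnit : m.toFunctor ⟶ (m.toFunctor ⋙ m.toFunctor) ⋙ m.coclosure.functor :=
  m.iso.hom ≫ m.familial.coclosureUnit (m.toFunctor ⋙ m.toFunctor)

instance isLeftKanExtension_coclosure :
    m.coclosure.functor.IsLeftKanExtension m.coclosureUnit := by
  let q := m.toFunctor ⋙ m.toFunctor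
  refine ⟨⟨Limits.IsInitial.ofUniqueHom (fun G => StructuredArrow.homMk
    ((m.familial.coclosure q).functor.descOfIsLeftKanExtension (m.familial.coclosureUnit q)
      G.right (m.iso.inv ≫ G.hom)) ?_) fun G k => ?_⟩⟩
  · have := (m.familial.coclosure q).functor.descOfIsLeftKanExtension_fac
      (m.familial.coclosureUnit q) G.right (m.iso.inv ≫ G.hom)
    exact (Category.assoc _ _ _).trans
      ((congrArg (fun t => m.iso.hom ≫ t) this).trans (Iso.hom_inv_id_assoc _ _))
  · ext1
    refine (m.familial.coclosure q).functor.hom_ext_of_isLeftKanExtension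
      (m.familial.coclosureUnit q) _ _ ?_
    refine Eq.trans ?_ ((m.familial.coclosure q).functor.descOfIsLeftKanExtension_fac
      (m.familial.coclosureUnit q) G.right (m.iso.inv ≫ G.hom)).symm
    have h := StructuredArrow.w k
    exact (Iso.eq_inv_comp m.iso).2 ((Category.assoc _ _ _).symm.trans h)

lemma coclosureUnit_naturality {X Y : c ⥤ Type u} (k : X ⟶ Y) :
    m.map k ≫ m.coclosureUnit.app Y =
      m.coclosureUnit.app X ≫ m.coclosure.functor.map (m.map (m.map k)) :=
  m.coclosureUnit.naturality k

lemma coclosure_hom_ext {G : (c ⥤ Type u) ⥤ (c ⥤ Type u)} (γ₁ γ₂ : m.coclosure.functor ⟶ G)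
    (h : ∀ X, m.coclosureUnit.app X ≫ γ₁.app (m.obj (m.obj X)) =
      m.coclosureUnit.app X ≫ γ₂.app (m.obj (m.obj X))) : γ₁ = γ₂ :=
  m.coclosure.functor.hom_ext_of_isLeftKanExtension m.coclosureUnit _ _
    (NatTrans.ext (funext h))

/-- The counit `[m / m ◁ m] ⟶ c`, corresponding to `m ◁ η : m ⟶ m ◁ m`. -/
noncomputable def coclosureCounit : m.coclosure.functor ⟶ 𝟭 (c ⥤ Type u) :=
  m.coclosure.functor.descOfIsLeftKanExtension m.coclosureUnit (𝟭 _)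
    { app := fun X => m.map (m.η.app X)
      naturality := fun X Y k => by
        change m.map k ≫ m.map (m.η.app Y) = m.map (m.η.app X) ≫ m.map (m.map k)
        rw [← m.map_comp, ← m.map_comp, m.toMonad.unit_naturality] }

/-- The comultiplication `[m / m ◁ m] ⟶ [m / m ◁ m] ◁ [m / m ◁ m]`, corresponding to the
composite `m ⟶ L ◁ m ◁ m ⟶ L ◁ L ◁ m ◁ m ◁ m ⟶ L ◁ L ◁ m ◁ m` of two applications of the
universal transformation followed by the multiplication of `m`, where `L = [m / m ◁ m]`. -/
noncomputable def coclosureComult :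
    m.coclosure.functor ⟶ m.coclosure.functor ⋙ m.coclosure.functor :=
  m.coclosure.functor.descOfIsLeftKanExtension m.coclosureUnit
    (m.coclosure.functor ⋙ m.coclosure.functor)
    { app := fun X => m.coclosureUnit.app X ≫
        m.coclosure.functor.map (m.coclosureUnit.app (m.obj X)) ≫
          m.coclosure.functor.map (m.coclosure.functor.map (m.map (m.μ.app X)))
      naturality := fun X Y k => by
        have h1 := m.coclosureUnit_naturality k
        have h2 := m.coclosureUnit_naturality (m.map k)
        have h3 : m.map (m.map k) ≫ m.μ.app Y = m.μ.app X ≫ m.map k := m.μ.naturality k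
        change m.map k ≫ m.coclosureUnit.app Y ≫
            m.coclosure.functor.map (m.coclosureUnit.app (m.obj Y)) ≫
              m.coclosure.functor.map (m.coclosure.functor.map (m.map (m.μ.app Y))) =
          (m.coclosureUnit.app X ≫ m.coclosure.functor.map (m.coclosureUnit.app (m.obj X)) ≫
            m.coclosure.functor.map (m.coclosure.functor.map (m.map (m.μ.app X)))) ≫
            m.coclosure.functor.map (m.coclosure.functor.map (m.map (m.map k)))
        rw [reassoc_of% h1]
        simp only [Category.assoc, ← Functor.map_comp, reassoc_of% h2]
        rw [h3] }

lemma coclosureUnit_counit (X : c ⥤ Type u) :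
    m.coclosureUnit.app X ≫ m.coclosureCounit.app (m.obj (m.obj X)) = m.map (m.η.app X) :=
  m.coclosure.functor.descOfIsLeftKanExtension_fac_app m.coclosureUnit _ _ X

lemma coclosureUnit_comult (X : c ⥤ Type u) :
    m.coclosureUnit.app X ≫ m.coclosureComult.app (m.obj (m.obj X)) =
      m.coclosureUnit.app X ≫ m.coclosure.functor.map (m.coclosureUnit.app (m.obj X)) ≫
        m.coclosure.functor.map (m.coclosure.functor.map (m.map (m.μ.app X))) :=
  m.coclosure.functor.descOfIsLeftKanExtension_fac_app m.coclosureUnit _ _ X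

lemma coclosureCounit_naturality {X Y : c ⥤ Type u} (k : X ⟶ Y) :
    m.coclosure.functor.map k ≫ m.coclosureCounit.app Y = m.coclosureCounit.app X ≫ k :=
  m.coclosureCounit.naturality k

lemma coclosureComult_naturality {X Y : c ⥤ Type u} (k : X ⟶ Y) :
    m.coclosure.functor.map k ≫ m.coclosureComult.app Y =
      m.coclosureComult.app X ≫ m.coclosure.functor.map (m.coclosure.functor.map k) :=
  m.coclosureComult.naturality k

/-- The familial comonad `[m / m ◁ m]`. -/
noncomputable def coclosureComonad : FamilialComonad c where
  toFamilial := m.coclosure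
  counit := m.coclosureCounit
  comult := m.coclosureComult
  counit_left X := by
    let γ : m.coclosure.functor ⟶ m.coclosure.functor :=
      { app := fun Y => m.coclosureComult.app Y ≫
          m.coclosureCounit.app (m.coclosure.functor.obj Y)
        naturality := fun Y Z k => by
          have h1 := m.coclosureComult_naturality k
          have h2 := m.coclosureCounit_naturality (m.coclosure.functor.map k)
          rw [reassoc_of% h1, h2, Category.assoc] }
    have : γ = 𝟙 _ := m.coclosure_hom_ext _ _ fun Y =>
      (comonad_law_left (T := m.toFunctor) (L := m.coclosure.functor)
        (η := fun X => m.η.app X) (μ := fun X => m.μ.app X) m.coclosureUnit_naturality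
        m.coclosureCounit_naturality m.coclosureUnit_counit m.coclosureUnit_comult
        m.right_unit Y).trans (Category.comp_id _).symm
    exact NatTrans.congr_app this X
  counit_right X := by
    let γ : m.coclosure.functor ⟶ m.coclosure.functor :=
      { app := fun Y => m.coclosureComult.app Y ≫
          m.coclosure.functor.map (m.coclosureCounit.app Y)
        naturality := fun Y Z k => by
          have h1 := m.coclosureComult_naturality k
          have h2 := m.coclosureCounit_naturality k
          rw [reassoc_of% h1, ← Functor.map_comp, h2, Functor.map_comp, Category.assoc] }
    have : γ = 𝟙 _ := m.coclosure_hom_ext _ _ fun Y =>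
      (comonad_law_right (T := m.toFunctor) (L := m.coclosure.functor)
        (η := fun X => m.η.app X) (μ := fun X => m.μ.app X)
        m.coclosureCounit_naturality m.coclosureUnit_counit m.coclosureUnit_comult
        m.left_unit Y).trans (Category.comp_id _).symm
    exact NatTrans.congr_app this X
  coassoc X := by
    let γ₁ : m.coclosure.functor ⟶
        m.coclosure.functor ⋙ m.coclosure.functor ⋙ m.coclosure.functor :=
      { app := fun Y => m.coclosureComult.app Y ≫
          m.coclosure.functor.map (m.coclosureComult.app Y)
        naturality := fun Y Z k => by
          have h1 := m.coclosureComult_naturality k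
          have h2 := m.coclosureComult_naturality k
          rw [reassoc_of% h1, ← Functor.map_comp, h2, Functor.map_comp, Category.assoc]
          rfl }
    let γ₂ : m.coclosure.functor ⟶
        m.coclosure.functor ⋙ m.coclosure.functor ⋙ m.coclosure.functor :=
      { app := fun Y => m.coclosureComult.app Y ≫
          m.coclosureComult.app (m.coclosure.functor.obj Y)
        naturality := fun Y Z k => by
          have h1 := m.coclosureComult_naturality k
          have h2 := m.coclosureComult_naturality (m.coclosure.functor.map k)
          rw [reassoc_of% h1, h2, Category.assoc]
          rfl }
    have : γ₁ = γ₂ := m.coclosure_hom_ext _ _ fun Y =>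
      comonad_law_assoc (T := m.toFunctor) (L := m.coclosure.functor)
        (μ := fun X => m.μ.app X) m.coclosureUnit_naturality
        m.coclosureComult_naturality m.coclosureUnit_comult m.assoc Y
    exact NatTrans.congr_app this X

/-- Compatibility of a transformation `m ⟶ a ◁ m ◁ m` with the counit and comultiplication of a
familial comonad `a` and with the unit and multiplication of (the rightmost copy of) `m`. -/
structure Compatible (A : FamilialComonad c)
    (α : m.toFunctor ⟶ (m.toFunctor ⋙ m.toFunctor) ⋙ A.functor) : Prop where
  counit : ∀ X, α.app X ≫ A.counit.app (m.obj (m.obj X)) = m.map (m.η.app X)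
  comult : ∀ X, α.app X ≫ A.comult.app (m.obj (m.obj X)) =
    α.app X ≫ A.functor.map (α.app (m.obj X)) ≫
      A.functor.map (A.functor.map (m.map (m.μ.app X)))

end FamilialMonad

end CatSharp

namespace CatSharp

/-! ### Morphisms of polynomials and of polynomial comonoids -/

/-! The Kan extension property of `L = [m / m ◁ m]` and its comonad structure come from the Yoneda
argument behind `isLeftKanExtension_coclosure`; what remains is to identify the carrier of `L` and
to classify maps out of it.

A direction of `L` at `M` is an element of `m(m(m[M]))`: an operation `N` together with a labelling
`m[N] ⟶ m(m[M])`. By freeness the labelling is the same as an algebra map `m(m[N]) ⟶ m(m[M])`, that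
is, a morphism `M ⟶ N` of `Θ_mᵒᵖ`. This is the bijection `dir`. The counit of `L` comes from `η`,
which is the restriction of an identity to generators (`dir_id`); the comultiplication comes from
applying `u` twice and then `μ`, which is Kleisli composition (`dir_comp`). So the bijection is an
isomorphism of comonoids, and it lies over `c` by naturality of `η`.

The correspondence with compatible transformations is a chain of bijections. Cofunctors are comonoid
homomorphisms (`Cofunctor.equivHom`), so cofunctors `Θ_mᵒᵖ ⟶ a` over `c` are homomorphisms over `c`
between the carriers of `L` and of `a`. These are the comonad homomorphisms `β : L ⟶ a`
(`FamilialComonad.homEquiv`). By the universal property of `u`, these correspond to the compatible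
`α : m ⟶ a ◁ m ◁ m` (`compatible_iff`).

The delicate link is `homEquiv`, since a morphism of carrier polynomials ignores the action of `c`
on directions. Being over `c` controls only the orbit of the identity direction; comultiplicativity
moves this control to every direction, so the map on directions is a morphism of copresheaves
(`exists_universal`). Conversely, an element of a familial functor is determined by its image in the
carrier (`eval_injective`), so laws that hold on carriers hold for `β`. -/

lemma poly_app_mk {p q : PFunctor.{u, u}} (h : polyFunctor p ⟶ polyFunctor q) {S : Type u}
    (P : p.A) (k : p.B P → S) :
    h.app S ⟨P, k⟩ = ⟨(h.app (p.B P) ⟨P, id⟩).1, fun d => k ((h.app (p.B P) ⟨P, id⟩).2 d)⟩ :=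
  ConcreteCategory.congr_hom (h.naturality (↾k : p.B P ⟶ S))
    (⟨P, id⟩ : (polyFunctor p).obj (p.B P))

/-- The Yoneda lemma for sums of representables: every element is the image of a generic element
`⟨P, id⟩` under some function of labels, so naturality leaves only the generic elements to compare.
-/
lemma poly_hom_ext {p q : PFunctor.{u, u}} {h h' : polyFunctor p ⟶ polyFunctor q}
    (w : ∀ P, h.app (p.B P) ⟨P, id⟩ = h'.app (p.B P) ⟨P, id⟩) : h = h' := by
  refine NatTrans.ext (funext fun S => type_hom_ext fun (z : (polyFunctor p).obj S) => ?_)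
  obtain ⟨P, k⟩ := z
  rw [poly_app_mk h, poly_app_mk h', w]

lemma PolyComonoid.Hom.counit_apply {x y : PolyComonoid.{u}} (h : x ⟶ y) {S : Type u}
    (z : (polyFunctor x.carrier).obj S) :
    y.counit.app S (h.hom.app S z) = x.counit.app S z :=
  ConcreteCategory.congr_hom (h.hom_counit S) z

lemma PolyComonoid.Hom.comult_apply {x y : PolyComonoid.{u}} (h : x ⟶ y) {S : Type u}
    (z : (polyFunctor x.carrier).obj S) :
    y.comult.app S (h.hom.app S z) =
      (polyFunctor y.carrier).map (h.hom.app S) (h.hom.app _ (x.comult.app S z)) :=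
  ConcreteCategory.congr_hom (h.hom_comult S) z

/-- A homomorphism of polynomial comonoids whose underlying morphism of polynomials is invertible
is an isomorphism. -/
noncomputable def PolyComonoid.isoOfIsIso {x y : PolyComonoid.{u}} (h : x ⟶ y) [IsIso h.hom] :
    x ≅ y where
  hom := h
  inv :=
    { hom := inv h.hom
      hom_counit := fun S => by
        rw [NatIso.isIso_inv_app, IsIso.inv_comp_eq, h.hom_counit]
      hom_comult := fun S => by
        rw [NatIso.isIso_inv_app, IsIso.inv_comp_eq, reassoc_of% h.hom_comult S]
        simp only [← NatTrans.naturality_assoc, ← NatTrans.naturality]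
        simp }
  hom_inv_id := PolyComonoid.Hom.ext (IsIso.hom_inv_id h.hom)
  inv_hom_id := PolyComonoid.Hom.ext (IsIso.inv_hom_id h.hom)

/-! ### Cofunctors are homomorphisms of polynomial comonoids -/

namespace Cofunctor

variable {a c : Type u} [SmallCategory a] [SmallCategory c]

/-- The morphism out of `x` lifting a morphism out of `φ(x)`. -/
def liftOut (φ : Cofunctor a c) (x : a) (f : Out (φ.obj x)) : Out x :=
  ⟨φ.cod x f.2, φ.lift x f.2⟩

/-- The types of `cod` and `lift` depend on `obj`. Packing object and lift into one pair keeps the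
hypothesis homogeneous, and it is exactly the value of `toHom` at a generic element. -/
lemma ext_liftOut {φ ψ : Cofunctor a c}
    (h : ∀ x, (⟨φ.obj x, φ.liftOut x⟩ : Σ d : c, Out d → Out x) = ⟨ψ.obj x, ψ.liftOut x⟩) :
    φ = ψ := by
  have h1 : φ.obj = ψ.obj := funext fun x => congrArg Sigma.fst (h x)
  obtain ⟨obj, cod, lift, _, _, _⟩ := φ
  obtain ⟨obj', cod', lift', _, _, _⟩ := ψ
  obtain rfl : obj = obj' := h1
  have h2 : ∀ x {d : c} (f : obj x ⟶ d), (⟨cod x f, lift x f⟩ : Out x) = ⟨cod' x f, lift' x f⟩ :=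
    fun x d f => congrFun (eq_of_heq (Sigma.mk.inj (h x)).2) (⟨d, f⟩ : Out (obj x))
  obtain rfl : @cod = @cod' := by
    funext x d f
    exact congrArg Sigma.fst (h2 x f)
  obtain rfl : @lift = @lift' := by
    funext x d f
    exact eq_of_heq (Sigma.mk.inj (h2 x f)).2
  rfl

lemma toHom_app (φ : Cofunctor a c) (x : a) :
    φ.toHom.hom.app (Out x) (⟨x, id⟩ : Σ y : a, Out y → Out x) = ⟨φ.obj x, φ.liftOut x⟩ :=
  rfl

lemma toHom_injective : Function.Injective (toHom : Cofunctor a c → _) := fun φ ψ h =>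
  ext_liftOut fun x => (φ.toHom_app x).symm.trans ((congrArg (fun t =>
    t.hom.app (Out x) (⟨x, id⟩ : Σ y : a, Out y → Out x)) h).trans
    (ψ.toHom_app x))

variable (h : PolyComonoid.ofCat a ⟶ PolyComonoid.ofCat c)

/-- The cofunctor given by a comonoid homomorphism, on objects. -/
def ofHomObj (x : a) : c :=
  (h.hom.app (Out x) (⟨x, id⟩ : Σ y : a, Out y → Out x)).1

/-- The cofunctor given by a comonoid homomorphism, on morphisms. -/
def ofHomLift (x : a) : Out (ofHomObj h x) → Out x :=
  (h.hom.app (Out x) (⟨x, id⟩ : Σ y : a, Out y → Out x)).2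

lemma hom_app_mk (x : a) {S : Type u} (k : Out x → S) :
    h.hom.app S (⟨x, k⟩ : Σ y : a, Out y → S) =
      (⟨ofHomObj h x, fun f => k (ofHomLift h x f)⟩ : Σ d : c, Out d → S) :=
  poly_app_mk h.hom (p := (PolyComonoid.ofCat a).carrier) x k

lemma ofHomLift_id (x : a) : ofHomLift h x ⟨ofHomObj h x, 𝟙 _⟩ = ⟨x, 𝟙 x⟩ :=
  PolyComonoid.Hom.counit_apply h (⟨x, id⟩ : Σ y : a, Out y → Out x)

/-- Comultiplicativity at the generic element of `x`, read at the direction `f`. The first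
components say that the lift of `f` has its codomain over that of `f`; the second components say
that lifts compose. -/
lemma ofHomLift_comp (x : a) (f : Out (ofHomObj h x)) :
    (⟨f.1, fun g => ofHomLift h x (comp f g)⟩ : Σ d : c, Out d → Out x) =
      ⟨ofHomObj h (ofHomLift h x f).1, fun g => comp (ofHomLift h x f) (ofHomLift h _ g)⟩ := by
  have h1 := PolyComonoid.Hom.comult_apply h (⟨x, id⟩ : Σ y : a, Out y → Out x)
  have h2 : h.hom.app _ ((PolyComonoid.ofCat a).comult.app (Out x)
      (⟨x, id⟩ : Σ y : a, Out y → Out x)) = _ :=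
    hom_app_mk h x fun f : Out x => (⟨f.1, fun g => comp f g⟩ : Σ y : a, Out y → Out x)
  rw [h2] at h1
  refine (congrFun (eq_of_heq (Sigma.mk.inj h1).2) f).trans ?_
  exact hom_app_mk h _ _

/-- The cofunctor given by a comonoid homomorphism. -/
def ofHom : Cofunctor a c where
  obj := ofHomObj h
  cod x d f := (ofHomLift h x ⟨d, f⟩).1
  lift x d f := (ofHomLift h x ⟨d, f⟩).2
  obj_cod x d f := (congrArg Sigma.fst (ofHomLift_comp h x ⟨d, f⟩)).symm
  lift_id x := ofHomLift_id h x
  lift_comp x d e f g := by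
    -- Equality of the pairs compares functions over different, propositionally equal, objects;
    -- evaluating them at one morphism costs an `eqToHom`.
    have key : ∀ (d' : c) (k : Out d → Out x) (k' : Out d' → Out x) (hd : d' = d)
        (_ : (⟨d, k⟩ : Σ d : c, Out d → Out x) = ⟨d', k'⟩),
        k ⟨e, g⟩ = k' ⟨e, eqToHom hd ≫ g⟩ := by
      rintro d' k k' rfl hk
      have h3 : eqToHom (rfl : d' = d') ≫ g = g := Category.id_comp _
      rw [h3, eq_of_heq (Sigma.mk.inj hk).2]
    exact key _ _ _ _ (ofHomLift_comp h x ⟨d, f⟩)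

lemma toHom_ofHom : (ofHom h).toHom = h :=
  PolyComonoid.Hom.ext (poly_hom_ext fun _ => rfl)

/-- Cofunctors are homomorphisms of polynomial comonoids. -/
def equivHom : Cofunctor a c ≃ (PolyComonoid.ofCat a ⟶ PolyComonoid.ofCat c) where
  toFun := toHom
  invFun := ofHom
  left_inv _ := toHom_injective (toHom_ofHom _)
  right_inv := toHom_ofHom

end Cofunctor

/-! ### Carriers of familial functors -/

namespace Familial

variable {c d : Type u} [SmallCategory c] [SmallCategory d] {p q : Familial c d}

/-- A morphism of copresheaves is determined by its function on elements. This is what allows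
equations between polynomial maps to be lifted back to equations in `p(X)`. -/
lemma eval_injective (p : Familial c d) {X : d ⥤ Type u} {S : Type u}
    {k : (Σ D : d, X.obj D) → S} (hk : Function.Injective k) :
    Function.Injective (p.eval k) := by
  rintro ⟨C, I, h⟩ ⟨C', I', h'⟩ hw
  have h1 : (⟨C, I⟩ : Σ C : c, p.ops.obj C) = ⟨C', I'⟩ := congrArg Sigma.fst hw
  obtain rfl : C = C' := congrArg Sigma.fst h1
  obtain rfl : I = I' := eq_of_heq (Sigma.mk.inj h1).2
  have h2 : (fun i : Σ D : d, (p.ar I).obj D => k ⟨i.1, h.app i.1 i.2⟩) =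
      fun i => k ⟨i.1, h'.app i.1 i.2⟩ := eq_of_heq (Sigma.mk.inj hw).2
  have h3 : h = h' := NatTrans.ext (funext fun D => type_hom_ext fun y =>
    eq_of_heq (Sigma.mk.inj (hk (congrFun h2 ⟨D, y⟩))).2)
  rw [h3]

lemma app_mk (β : p.functor ⟶ q.functor) {X : d ⥤ Type u} {C : c} (I : p.ops.obj C)
    (x : p.ar I ⟶ X) :
    (β.app X).app C ⟨I, x⟩ = (q.functor.map x).app C ((β.app (p.ar I)).app C ⟨I, 𝟙 _⟩) := by
  have h1 : (β.app X).app C ⟨I, 𝟙 _ ≫ x⟩ = _ :=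
    ConcreteCategory.congr_hom (NatTrans.congr_app (β.naturality x) C)
      (⟨I, 𝟙 _⟩ : Σ J : p.ops.obj C, (p.ar J ⟶ p.ar I))
  rwa [Category.id_comp] at h1

lemma carrierMap_eval (β : p.functor ⟶ q.functor) {X : d ⥤ Type u} {S : Type u}
    (k : (Σ D : d, X.obj D) → S) (w : Σ C : c, (p.functor.obj X).obj C) :
    (carrierMap β).app S (p.eval k w) = q.eval k ⟨w.1, (β.app X).app w.1 w.2⟩ := by
  obtain ⟨C, I, x⟩ := w
  rw [app_mk]
  rfl

/-- Labelling the arity by the elements of `X` themselves (`k = id`) loses nothing under `eval`, so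
each component of `β` can be read off from `carrierMap β`. -/
lemma carrierMap_injective :
    Function.Injective (carrierMap : (p.functor ⟶ q.functor) → _) := by
  intro β β' h
  refine NatTrans.ext (funext fun X => NatTrans.ext (funext fun C => type_hom_ext fun
    (z : Σ I : p.ops.obj C, (p.ar I ⟶ X)) => ?_))
  have h1 := congrArg (fun t => t.app _ (p.eval id ⟨C, z⟩)) h
  dsimp only at h1
  rw [carrierMap_eval, carrierMap_eval] at h1
  exact eq_of_heq (Sigma.mk.inj (q.eval_injective Function.injective_id h1)).2

end Familial

/-! ### Homomorphisms of familial comonads -/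

namespace FamilialComonad

variable {c : Type u} [SmallCategory c]

/-- A transformation is a homomorphism of familial comonads. -/
structure IsHom (E A : FamilialComonad c) (β : E.functor ⟶ A.functor) : Prop where
  counit : ∀ X, β.app X ≫ A.counit.app X = E.counit.app X
  comult : ∀ X, β.app X ≫ A.comult.app X =
    E.comult.app X ≫ β.app (E.functor.obj X) ≫ A.functor.map (β.app X)

variable {E A : FamilialComonad c}

lemma orbit_eval {X : c ⥤ Type u} {S : Type u} (k : (Σ D : c, X.obj D) → S)
    (w : Σ C : c, (E.functor.obj X).obj C) :
    E.proj.hom.app S (E.eval k w) = orbit k (E.counitAt X w) := by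
  obtain ⟨C, J, h⟩ := w
  unfold counitAt
  rw [counit_apply]
  change (⟨C, fun f => k ⟨f.1, h.app f.1 ((E.ar J).map f.2 (E.idDir J))⟩⟩ :
    Σ C : c, Out C → S) = ⟨C, fun f => k ⟨f.1, X.map f.2 (h.app C (E.idDir J))⟩⟩
  congr 1
  funext f
  rw [NatTrans.naturality_apply]

/-- The homomorphism of carrier comonoids underlying a homomorphism of familial comonads. -/
def IsHom.toHom {β : E.functor ⟶ A.functor} (hβ : IsHom E A β) : E.comonoid ⟶ A.comonoid where
  hom := Familial.carrierMap β
  hom_counit S := by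
    refine type_hom_ext fun (z : (polyFunctor E.carrier).obj S) => ?_
    obtain ⟨⟨C, I⟩, k⟩ := z
    refine (A.carrierCounit_eval k ⟨C, (β.app (E.ar I)).app C ⟨I, 𝟙 _⟩⟩).trans ?_
    have h : (A.counit.app (E.ar I)).app C ((β.app (E.ar I)).app C ⟨I, 𝟙 _⟩) = E.idDir I :=
      ConcreteCategory.congr_hom (NatTrans.congr_app (hβ.counit (E.ar I)) C) _
    change k ⟨C, (A.counit.app (E.ar I)).app C ((β.app (E.ar I)).app C ⟨I, 𝟙 _⟩)⟩ = _
    rw [h]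
    rfl
  hom_comult S := by
    refine type_hom_ext fun (z : (polyFunctor E.carrier).obj S) => ?_
    obtain ⟨⟨C, I⟩, k⟩ := z
    refine (A.carrierComult_eval k ⟨C, (β.app (E.ar I)).app C ⟨I, 𝟙 _⟩⟩).trans ?_
    have h : (A.comult.app (E.ar I)).app C ((β.app (E.ar I)).app C ⟨I, 𝟙 _⟩) =
        (A.functor.map (β.app (E.ar I))).app C
          ((β.app (E.functor.obj (E.ar I))).app C (E.split I)) :=
      ConcreteCategory.congr_hom (NatTrans.congr_app (hβ.comult (E.ar I)) C) _
    change A.eval (A.eval k)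
      ⟨C, (A.comult.app (E.ar I)).app C ((β.app (E.ar I)).app C ⟨I, 𝟙 _⟩)⟩ =
      (polyFunctor A.carrier).map ((Familial.carrierMap β).app S)
        ((Familial.carrierMap β).app _ (E.eval (E.eval k) ⟨C, E.split I⟩))
    rw [h, Familial.carrierMap_eval]
    exact congrArg (fun l => A.eval l ⟨C, (β.app (E.functor.obj (E.ar I))).app C (E.split I)⟩)
      (funext fun w => (Familial.carrierMap_eval β k w).symm)

/-- The projection to `c` depends only on the orbit of the counit's value, and `β` respects counits.
-/
lemma IsHom.toHom_proj {β : E.functor ⟶ A.functor} (hβ : IsHom E A β) :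
    hβ.toHom ≫ A.proj = E.proj := by
  refine PolyComonoid.Hom.ext (poly_hom_ext fun P => ?_)
  obtain ⟨C, I⟩ := P
  refine (orbit_eval (E := A) id ⟨C, (β.app (E.ar I)).app C ⟨I, 𝟙 _⟩⟩).trans ?_
  have h : (A.counit.app (E.ar I)).app C ((β.app (E.ar I)).app C ⟨I, 𝟙 _⟩) = E.idDir I :=
    ConcreteCategory.congr_hom (NatTrans.congr_app (hβ.counit (E.ar I)) C) _
  change orbit id ⟨C, (A.counit.app (E.ar I)).app C ((β.app (E.ar I)).app C ⟨I, 𝟙 _⟩)⟩ = _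
  rw [h]
  rfl

/-- A function between sets of elements that preserves orbits is given by a morphism of
copresheaves. -/
lemma exists_hom_of_orbit {X Y : c ⥤ Type u} (κ : (Σ D : c, X.obj D) → Σ D : c, Y.obj D)
    (h : ∀ d, orbit κ d = orbit id (κ d)) :
    ∃ k : X ⟶ Y, κ = fun d => ⟨d.1, k.app d.1 d.2⟩ := by
  -- An orbit records its base object and its translates: the former gives preservation of the
  -- grading, the latter naturality.
  have h1 : ∀ d, (κ d).1 = d.1 := fun d => (congrArg Sigma.fst (h d)).symm
  have h2 : ∀ d : Σ D : c, X.obj D, ∃ y : Y.obj d.1, κ d = ⟨d.1, y⟩ := by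
    rintro d
    have := h1 d
    generalize κ d = w at this
    obtain ⟨D, y⟩ := w
    dsimp only at this
    subst this
    exact ⟨y, rfl⟩
  choose k hk using h2
  refine ⟨{ app := fun D => ↾fun x => k ⟨D, x⟩, naturality := fun D D' g => ?_ }, funext hk⟩
  refine type_hom_ext fun x => ?_
  have h3 := h ⟨D, x⟩
  rw [hk] at h3
  have h4 : κ ⟨D', X.map g x⟩ = ⟨D', Y.map g (k ⟨D, x⟩)⟩ :=
    congrFun (eq_of_heq (Sigma.mk.inj h3).2) (⟨D', g⟩ : Out D)
  rw [hk] at h4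
  exact eq_of_heq (Sigma.mk.inj h4).2

/-- The right counit law forces the comultiplication to keep the operation `I` and makes `s` a
section of the counit; the left counit law says that `s` takes the identity direction to the generic
element of `I`. -/
lemma exists_split (E : FamilialComonad c) {C : c} (I : E.ops.obj C) :
    ∃ s : E.ar I ⟶ E.functor.obj (E.ar I), E.split I = ⟨I, s⟩ ∧
      s ≫ E.counit.app (E.ar I) = 𝟙 _ ∧ s.app C (E.idDir I) = ⟨I, 𝟙 _⟩ := by
  have h : (E.functor.map (E.counit.app (E.ar I))).app C (E.split I) = ⟨I, 𝟙 _⟩ :=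
    ConcreteCategory.congr_hom (NatTrans.congr_app (E.counit_right (E.ar I)) C) _
  have h' : (E.counit.app (E.functor.obj (E.ar I))).app C (E.split I) = ⟨I, 𝟙 _⟩ :=
    ConcreteCategory.congr_hom (NatTrans.congr_app (E.counit_left (E.ar I)) C) _
  generalize E.split I = z at h h' ⊢
  obtain ⟨J, s⟩ := z
  obtain rfl : J = I := congrArg Sigma.fst h
  refine ⟨s, rfl, eq_of_heq (Sigma.mk.inj h).2, ?_⟩
  rwa [counit_apply] at h'

end FamilialComonad

/-! ### Recovering a transformation from a homomorphism of carriers over `c`. -/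

namespace FamilialComonad

variable {c : Type u} [SmallCategory c] {E A : FamilialComonad c}

/-- The universal element of the carrier polynomial at an operation. -/
def gen (E : FamilialComonad c) {C : c} (I : E.ops.obj C) :
    (polyFunctor E.carrier).obj (Σ D : c, (E.ar I).obj D) :=
  E.eval id ⟨C, ⟨I, 𝟙 (E.ar I)⟩⟩

lemma hom_eval (f : polyFunctor E.carrier ⟶ polyFunctor A.carrier) {X : c ⥤ Type u}
    {S : Type u} (k : (Σ D : c, X.obj D) → S) {C : c} (I : E.ops.obj C) (x : E.ar I ⟶ X) :
    f.app S (E.eval k ⟨C, ⟨I, x⟩⟩) =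
      (polyFunctor A.carrier).map (↾fun d => k ⟨d.1, x.app d.1 d.2⟩) (f.app _ (E.gen I)) :=
  ConcreteCategory.congr_hom (f.naturality (↾fun d => k ⟨d.1, x.app d.1 d.2⟩)) (E.gen I)

/-- What `h` does to the generic element of `I`. Compatibility with the projections places `J` over
the same object and fixes `κ` on the orbit of the identity; comultiplicativity, read one direction
`d` at a time, expresses `h` after a step along `κ d` through `κ` itself. -/
lemma exists_dirs (h : E.comonoid ⟶ A.comonoid) (hp : h ≫ A.proj = E.proj)
    {C : c} (I : E.ops.obj C) :
    ∃ (J : A.ops.obj C) (κ : (Σ D : c, (A.ar J).obj D) → Σ D : c, (E.ar I).obj D),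
      h.hom.app _ (E.gen I) = ⟨⟨C, J⟩, κ⟩ ∧
      orbit κ ⟨C, A.idDir J⟩ = orbit id ⟨C, E.idDir I⟩ ∧
      ∀ s t, E.split I = ⟨I, s⟩ → A.split J = ⟨J, t⟩ →
        ∀ d, A.eval κ ⟨d.1, t.app d.1 d.2⟩ =
          h.hom.app _ (E.eval id ⟨(κ d).1, s.app _ (κ d).2⟩) := by
  have h1 : A.proj.hom.app _ (h.hom.app _ (E.gen I)) = orbit id ⟨C, E.idDir I⟩ :=
    ConcreteCategory.congr_hom (NatTrans.congr_app (congrArg PolyComonoid.Hom.hom hp) _) (E.gen I)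
  have h2 := PolyComonoid.Hom.comult_apply h (E.gen I)
  generalize hz : h.hom.app _ (E.gen I) = z at h1 h2
  obtain ⟨⟨C', J⟩, κ⟩ := z
  obtain rfl : C' = C := congrArg Sigma.fst h1
  refine ⟨J, κ, rfl, h1, fun s t hs ht => ?_⟩
  have h3 : (A.comonoid.comult.app _ ⟨⟨C', J⟩, κ⟩ : (polyFunctor A.carrier).obj _) =
      A.eval (A.eval κ) ⟨C', ⟨J, t⟩⟩ := by
    rw [← ht]
    rfl
  have h4 : E.comonoid.comult.app _ (E.gen I) = E.eval (E.eval id) ⟨C', ⟨I, s⟩⟩ := by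
    rw [← hs]
    rfl
  have h5 := (hom_eval h.hom (E.eval id) I s).trans
    (congrArg ((polyFunctor A.carrier).map (↾fun d => E.eval id ⟨d.1, s.app d.1 d.2⟩)) hz)
  rw [h4] at h2
  exact congrFun (eq_of_heq (Sigma.mk.inj (h3.symm.trans (h2.trans
    (congrArg ((polyFunctor A.carrier).map (h.hom.app _)) h5)))).2)

/-- The element `w` will be the value of the transformation at the generic element of `I`; the
clause about `g` supplies naturality in the object of `c`. -/
lemma exists_universal (h : E.comonoid ⟶ A.comonoid) (hp : h ≫ A.proj = E.proj)
    {C : c} (I : E.ops.obj C) :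
    ∃ w : (A.functor.obj (E.ar I)).obj C,
      h.hom.app _ (E.gen I) = A.eval id ⟨C, w⟩ ∧
      ∀ {D : c} (g : C ⟶ D),
        h.hom.app _ (E.eval id ⟨D, ⟨E.ops.map g I, E.res g I⟩⟩) =
          A.eval id ⟨D, (A.functor.obj (E.ar I)).map g w⟩ := by
  obtain ⟨J, κ, hJ, hκ, hst⟩ := exists_dirs h hp I
  obtain ⟨s, hs, hsε, hs1⟩ := E.exists_split I
  obtain ⟨t, ht, htε, ht1⟩ := A.exists_split J
  replace hst := hst s t hs ht
  -- Project both sides of the comultiplication identity at `d` to `c`. As `t` and `s` are sections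
  -- of the counits, the two orbits are those of `d` and `κ d`.
  have hc : ∀ d : Σ D : c, (A.ar J).obj D, orbit κ d = orbit id (κ d) := fun d => by
    have h1 := orbit_eval (E := A) κ ⟨d.1, t.app d.1 d.2⟩
    have h2 := orbit_eval (E := E) id ⟨(κ d).1, s.app _ (κ d).2⟩
    have h3 : A.proj.hom.app _ (h.hom.app _ (E.eval id ⟨(κ d).1, s.app _ (κ d).2⟩)) =
        E.proj.hom.app _ (E.eval id ⟨(κ d).1, s.app _ (κ d).2⟩) :=
      ConcreteCategory.congr_hom (NatTrans.congr_app (congrArg PolyComonoid.Hom.hom hp) _) _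
    have h4 : A.counitAt (A.ar J) ⟨d.1, t.app d.1 d.2⟩ = d :=
      congrArg (Sigma.mk d.1) (ConcreteCategory.congr_hom (NatTrans.congr_app htε d.1) d.2)
    have h5 : E.counitAt (E.ar I) ⟨(κ d).1, s.app _ (κ d).2⟩ = κ d :=
      congrArg (Sigma.mk (κ d).1)
        (ConcreteCategory.congr_hom (NatTrans.congr_app hsε (κ d).1) (κ d).2)
    rw [h4, hst] at h1
    rw [h5] at h2
    exact h1.symm.trans (h3.trans h2)
  obtain ⟨k, rfl⟩ := exists_hom_of_orbit κ hc
  refine ⟨⟨J, k⟩, hJ, fun {D} g => ?_⟩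
  have h1 : k.app D ((A.ar J).map g (A.idDir J)) = (E.ar I).map g (E.idDir I) :=
    eq_of_heq (Sigma.mk.inj (congrFun (eq_of_heq (Sigma.mk.inj hκ).2) (⟨D, g⟩ : Out C))).2
  -- The same identity at the translate by `g` of the identity direction: `t` and `s` send these
  -- translates to the restrictions of `J` and `I` along `g`.
  have h2 := hst ⟨D, (A.ar J).map g (A.idDir J)⟩
  dsimp only at h2
  have h3 : t.app D ((A.ar J).map g (A.idDir J)) =
      (⟨A.ops.map g J, A.res g J⟩ : (A.functor.obj (A.ar J)).obj D) := by
    rw [NatTrans.naturality_apply, ht1]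
    exact congrArg (Sigma.mk (A.ops.map g J)) (Category.comp_id _)
  have h4 : s.app D ((E.ar I).map g (E.idDir I)) =
      (⟨E.ops.map g I, E.res g I⟩ : (E.functor.obj (E.ar I)).obj D) := by
    rw [NatTrans.naturality_apply, hs1]
    exact congrArg (Sigma.mk (E.ops.map g I)) (Category.comp_id _)
  rw [h1, h3, h4] at h2
  exact h2.symm

/-- Every homomorphism of carrier comonoids over `c` underlies a transformation. -/
lemma exists_carrierMap_eq (h : E.comonoid ⟶ A.comonoid) (hp : h ≫ A.proj = E.proj) :
    ∃ β : E.functor ⟶ A.functor, Familial.carrierMap β = h.hom := by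
  choose w hw hg using fun (C : c) (I : E.ops.obj C) => exists_universal h hp I
  -- Two expressions for `h` at the restriction of the generic element of `I` along `g`; injectivity
  -- of `eval id` equates the underlying elements. This is the Yoneda condition for the family `w`
  -- to define a transformation.
  have nat : ∀ {C D : c} (g : C ⟶ D) (I : E.ops.obj C),
      (A.functor.map (E.res g I)).app D (w D (E.ops.map g I)) =
        (A.functor.obj (E.ar I)).map g (w C I) := fun {C D} g I => by
    have h1 := (congrArg ((polyFunctor A.carrier).map
      (↾fun d => (⟨d.1, (E.res g I).app d.1 d.2⟩ : Σ D : c, (E.ar I).obj D)))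
        (hw D (E.ops.map g I))).symm.trans ((hom_eval h.hom id _ (E.res g I)).symm.trans (hg C I g))
    exact eq_of_heq (Sigma.mk.inj (A.eval_injective Function.injective_id
      (a₁ := ⟨D, (A.functor.map (E.res g I)).app D (w D (E.ops.map g I))⟩) h1)).2
  refine ⟨{ app := fun X =>
              { app := fun C => ↾fun z => (A.functor.map z.2).app C (w C z.1)
                naturality := fun C D g => ?_ }
            naturality := fun X Y k => ?_ }, ?_⟩
  · refine type_hom_ext fun (z : Σ I : E.ops.obj C, (E.ar I ⟶ X)) => ?_
    obtain ⟨I, x⟩ := z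
    change (A.functor.map (E.res g I ≫ x)).app D (w D (E.ops.map g I)) =
      (A.functor.obj X).map g ((A.functor.map x).app C (w C I))
    rw [← NatTrans.naturality_apply, ← nat, Functor.map_comp]
    rfl
  · refine NatTrans.ext (funext fun C => type_hom_ext fun
      (z : Σ I : E.ops.obj C, (E.ar I ⟶ X)) => ?_)
    change (A.functor.map (z.2 ≫ k)).app C (w C z.1) =
      (A.functor.map k).app C ((A.functor.map z.2).app C (w C z.1))
    rw [Functor.map_comp]
    rfl
  · refine poly_hom_ext fun P => ?_
    obtain ⟨C, I⟩ := P
    refine Eq.trans ?_ (hw C I).symm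
    change A.eval id ⟨C, (A.functor.map (𝟙 _)).app C (w C I)⟩ = _
    rw [CategoryTheory.Functor.map_id]
    rfl

lemma isHom_of_carrierMap_eq (h : E.comonoid ⟶ A.comonoid) (β : E.functor ⟶ A.functor)
    (hβ : Familial.carrierMap β = h.hom) : IsHom E A β := by
  have app_eval : ∀ {X : c ⥤ Type u} {S : Type u} (k : (Σ D : c, X.obj D) → S)
      (w : Σ C : c, (E.functor.obj X).obj C),
      h.hom.app S (E.eval k w) = A.eval k ⟨w.1, (β.app X).app w.1 w.2⟩ := fun k w =>
    (congrArg (fun t => t.app _ (E.eval k w)) hβ.symm).trans (Familial.carrierMap_eval β k w)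
  refine ⟨fun X => NatTrans.ext (funext fun C => type_hom_ext fun z => ?_),
    fun X => NatTrans.ext (funext fun C => type_hom_ext fun z => ?_)⟩
  · have h1 := PolyComonoid.Hom.counit_apply h (E.eval id ⟨C, z⟩)
    rw [app_eval] at h1
    exact eq_of_heq (Sigma.mk.inj ((A.carrierCounit_eval id _).symm.trans
      (h1.trans (E.carrierCounit_eval id ⟨C, z⟩)))).2
  · have h1 := PolyComonoid.Hom.comult_apply h (E.eval id ⟨C, z⟩)
    have h2 : E.comonoid.comult.app _ (E.eval id ⟨C, z⟩) = _ := E.carrierComult_eval id ⟨C, z⟩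
    rw [h2, app_eval] at h1
    replace h1 := h1.trans (congrArg ((polyFunctor A.carrier).map (h.hom.app _)) (app_eval _ _))
    have h3 := (A.carrierComult_eval id ⟨C, (β.app X).app C z⟩).symm.trans (h1.trans
      (congrArg (fun l => A.eval l
        ⟨C, (β.app (E.functor.obj X)).app C ((E.comult.app X).app C z)⟩)
        (funext fun w => app_eval id w)))
    exact eq_of_heq (Sigma.mk.inj (A.eval_injective (A.eval_injective Function.injective_id)
      (a₂ := ⟨C, (A.functor.map (β.app X)).app C
        ((β.app (E.functor.obj X)).app C ((E.comult.app X).app C z))⟩) h3)).2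

/-- Homomorphisms of familial comonads on `c` are the homomorphisms of carrier comonoids over
`c`. -/
noncomputable def homEquiv (E A : FamilialComonad c) :
    {β : E.functor ⟶ A.functor // IsHom E A β} ≃
      {h : E.comonoid ⟶ A.comonoid // h ≫ A.proj = E.proj} :=
  Equiv.ofBijective (fun β => ⟨β.2.toHom, β.2.toHom_proj⟩)
    ⟨fun β γ h => Subtype.ext (Familial.carrierMap_injective
      (congrArg (fun t => t.1.hom) h)), fun h => by
      obtain ⟨β, hβ⟩ := exists_carrierMap_eq h.1 h.2
      exact ⟨⟨β, isHom_of_carrierMap_eq h.1 β hβ⟩, Subtype.ext (PolyComonoid.Hom.ext hβ)⟩⟩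

end FamilialComonad

namespace Cofunctor

lemma comonoidIso_hom_toHom {a c : Type u} [SmallCategory a] [SmallCategory c]
    (φ : Cofunctor a c) : φ.comonoidIso.hom ≫ φ.toHom = φ.comonad.proj := by
  refine PolyComonoid.Hom.ext (poly_hom_ext fun P => ?_)
  obtain ⟨_, x, rfl⟩ := P
  refine congrArg (Sigma.mk (φ.obj x)) (funext fun f : Out (φ.obj x) => ?_)
  -- Elements of `a[x]` carry a proof of their grade, so an equality of morphisms out of `x` must
  -- also be moved across grades.
  have key : ∀ (F F' : Out x) (h : φ.obj F'.1 = f.1), F = F' →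
      (⟨φ.obj F.1, ⟨F, rfl⟩⟩ : Σ D : c, {f : Out x // φ.obj f.1 = D}) = ⟨f.1, ⟨F', h⟩⟩ := by
    rintro F _ h rfl
    obtain ⟨D, g⟩ := f
    dsimp only at h
    subst h
    rfl
  refine key _ _ _ ((φ.act_rfl x f.2).symm.trans ?_)
  change φ.act x rfl f.2 = comp ⟨x, 𝟙 x⟩ (φ.act x rfl f.2)
  simp [comp]

end Cofunctor

namespace FamilialMonad

variable {c : Type u} [SmallCategory c] (m : FamilialMonad c)

/-! ### The category `Θ_mᵒᵖ` and the carrier comonoid of the coclosure -/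

/-- The element of `m(X)` given by an operation and a labelling of its arity. -/
def elt {X : c ⥤ Type u} {D : c} (N : m.familial.ops.obj D) (x : m.familial.ar N ⟶ X) :
    (m.obj X).obj D :=
  (m.iso.inv.app X).app D ⟨N, x⟩

lemma iso_hom_elt {X : c ⥤ Type u} {D : c} (N : m.familial.ops.obj D)
    (x : m.familial.ar N ⟶ X) : (m.iso.hom.app X).app D (m.elt N x) = ⟨N, x⟩ :=
  ConcreteCategory.congr_hom (NatTrans.congr_app (m.iso.inv_hom_id_app X) D) _

lemma elt_iso_hom {X : c ⥤ Type u} {D : c} (y : (m.obj X).obj D) :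
    m.elt ((m.iso.hom.app X).app D y).1 ((m.iso.hom.app X).app D y).2 = y :=
  ConcreteCategory.congr_hom (NatTrans.congr_app (m.iso.hom_inv_id_app X) D) _

lemma map_elt {X Y : c ⥤ Type u} {D : c} (N : m.familial.ops.obj D) (x : m.familial.ar N ⟶ X)
    (k : X ⟶ Y) : (m.map k).app D (m.elt N x) = m.elt N (x ≫ k) :=
  (ConcreteCategory.congr_hom (NatTrans.congr_app (m.iso.inv.naturality k) D)
    (⟨N, x⟩ : Σ I : m.familial.ops.obj D, (m.familial.ar I ⟶ X))).symm

lemma elt_map {X : c ⥤ Type u} {C D : c} (g : C ⟶ D) (N : m.familial.ops.obj C)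
    (x : m.familial.ar N ⟶ X) :
    (m.obj X).map g (m.elt N x) = m.elt (m.familial.ops.map g N) (m.familial.res g N ≫ x) :=
  (NatTrans.naturality_apply (m.iso.inv.app X) g
    (⟨N, x⟩ : Σ I : m.familial.ops.obj C, (m.familial.ar I ⟶ X))).symm

lemma coclosureUnit_elt {X : c ⥤ Type u} {D : c} (N : m.familial.ops.obj D)
    (x : m.familial.ar N ⟶ X) :
    (m.coclosureUnit.app X).app D (m.elt N x) = ⟨N, m.map (m.map x)⟩ :=
  congrArg ((m.familial.coclosureUnit (m.toFunctor ⋙ m.toFunctor)).app X |>.app D)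
    (m.iso_hom_elt N x)

/-- The generic element of `L` at `I` lies in the image of `u`. Hence the counit and
comultiplication, known only through their composites with `u`, can be computed there. -/
lemma coclosureUnit_gen {C : c} (I : m.familial.ops.obj C) :
    (m.coclosureUnit.app (m.familial.ar I)).app C (m.elt I (𝟙 _)) =
      (⟨I, 𝟙 (m.obj (m.obj (m.familial.ar I)))⟩ :
        Σ J : m.familial.ops.obj C, (m.obj (m.obj (m.familial.ar J)) ⟶ _)) := by
  refine (m.coclosureUnit_elt I (𝟙 _)).trans (congrArg (fun x => (⟨I, x⟩ :
    Σ J : m.familial.ops.obj C, (m.obj (m.obj (m.familial.ar J)) ⟶ _))) ?_)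
  exact (congrArg m.map (m.map_id (m.familial.ar I))).trans (m.map_id _)

lemma idDir_eq {C : c} (I : m.familial.ops.obj C) :
    m.coclosureComonad.idDir I = m.elt I (m.η.app (m.familial.ar I)) := by
  have h1 : (m.coclosureCounit.app (m.obj (m.obj (m.familial.ar I)))).app C
      ((m.coclosureUnit.app (m.familial.ar I)).app C (m.elt I (𝟙 _))) =
        (m.map (m.η.app (m.familial.ar I))).app C (m.elt I (𝟙 _)) :=
    ConcreteCategory.congr_hom (NatTrans.congr_app (m.coclosureUnit_counit _) C) _
  rw [coclosureUnit_gen, map_elt, Category.id_comp] at h1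
  exact h1

lemma split_eq {C : c} (I : m.familial.ops.obj C) :
    m.coclosureComonad.split I = ⟨I, m.coclosureUnit.app (m.obj (m.familial.ar I)) ≫
      m.coclosure.functor.map (m.map (m.μ.app (m.familial.ar I)))⟩ := by
  have h1 : (m.coclosureComult.app (m.obj (m.obj (m.familial.ar I)))).app C
      ((m.coclosureUnit.app (m.familial.ar I)).app C (m.elt I (𝟙 _))) =
      (m.coclosure.functor.map (m.coclosure.functor.map (m.map (m.μ.app (m.familial.ar I))))).app C
      ((m.coclosure.functor.map (m.coclosureUnit.app (m.obj (m.familial.ar I)))).app C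
        ((m.coclosureUnit.app (m.familial.ar I)).app C (m.elt I (𝟙 _)))) :=
    ConcreteCategory.congr_hom (NatTrans.congr_app (m.coclosureUnit_comult _) C) _
  rw [coclosureUnit_gen] at h1
  refine h1.trans (congrArg (Sigma.mk I) ?_)
  exact congrArg (· ≫ _) (Category.id_comp _)

/-! ### Morphisms of `Θ_m` as directions of the coclosure. -/

variable {m} in
/-- The morphism of copresheaves underlying a morphism of `Θ_m`. -/
def under {s t : m.Theory} (f : s ⟶ t) :
    m.obj (m.familial.ar s.2) ⟶ m.obj (m.familial.ar t.2) :=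
  f.hom.f

lemma map_under {s t : m.Theory} (f : s ⟶ t) :
    m.map (under f) ≫ m.μ.app _ = m.μ.app _ ≫ under f :=
  f.hom.h

/-- An algebra map out of a free algebra is the Kleisli extension of its restriction to generators.
-/
lemma map_unit_under {s t : m.Theory} (f : s ⟶ t) :
    m.map (m.η.app _ ≫ under f) ≫ m.μ.app _ = under f := by
  rw [m.map_comp, Category.assoc, map_under]
  exact m.toMonad.right_unit_assoc _ _

/-- Morphisms of `Θ_m` are given by their restriction to generators. -/
def theoryHomEquiv (s t : m.Theory) :
    (s ⟶ t) ≃ (m.familial.ar s.2 ⟶ m.obj (m.familial.ar t.2)) where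
  toFun f := m.η.app _ ≫ under f
  invFun x := InducedCategory.homMk
    { f := m.map x ≫ m.μ.app _
      h := by
        have h1 : m.map (m.map x) ≫ m.μ.app _ = m.μ.app _ ≫ m.map x := m.μ.naturality x
        have h2 : m.map (m.μ.app _) ≫ m.μ.app (m.familial.ar t.2) = m.μ.app _ ≫ m.μ.app _ :=
          m.toMonad.assoc _
        change m.map (m.map x ≫ m.μ.app _) ≫ m.μ.app _ = m.μ.app _ ≫ m.map x ≫ m.μ.app _
        rw [m.map_comp, Category.assoc, h2, reassoc_of% h1] }
  left_inv f := InducedCategory.hom_ext (Monad.Algebra.Hom.ext (m.map_unit_under f))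
  right_inv x := by
    change m.η.app _ ≫ m.map x ≫ m.μ.app _ = x
    have h : x ≫ m.η.app _ = m.η.app _ ≫ m.map x := m.η.naturality x
    rw [← reassoc_of% h]
    exact (congrArg (x ≫ ·) (m.toMonad.left_unit _)).trans (Category.comp_id _)

/-- The element of `m(m(m[M]))` corresponding to a morphism `m(m[N]) ⟶ m(m[M])` of algebras. -/
def dir (s : m.Theory) (f : Out (op s)) : Σ D : c, (m.obj (m.obj (m.familial.ar s.2))).obj D :=
  ⟨f.1.unop.1, m.elt f.1.unop.2 (m.η.app _ ≫ under f.2.unop)⟩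

/-- An element of `m(Y)` is an operation `N` with a labelling `m[N] ⟶ Y`; for `Y = m(m[M])`,
`theoryHomEquiv` turns labellings into algebra maps. -/
lemma dir_bijective (s : m.Theory) : Function.Bijective (m.dir s) := by
  constructor
  · rintro ⟨⟨N⟩, f⟩ ⟨⟨N'⟩, f'⟩ h
    obtain ⟨D, N⟩ := N
    obtain ⟨D', N'⟩ := N'
    obtain rfl : D = D' := congrArg Sigma.fst h
    have h1 := congrArg ((m.iso.hom.app _).app D) (eq_of_heq (Sigma.mk.inj h).2)
    rw [iso_hom_elt, iso_hom_elt] at h1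
    obtain rfl : N = N' := congrArg Sigma.fst h1
    have h2 : f = f' := Quiver.Hom.unop_inj
      ((m.theoryHomEquiv ⟨D, N⟩ s).injective (eq_of_heq (Sigma.mk.inj h1).2))
    rw [h2]
  · rintro ⟨D, y⟩
    let z := (m.iso.hom.app _).app D y
    refine ⟨⟨op ⟨D, z.1⟩, ((m.theoryHomEquiv ⟨D, z.1⟩ s).symm z.2).op⟩, ?_⟩
    refine congrArg (Sigma.mk D) (Eq.trans ?_ (m.elt_iso_hom y))
    exact congrArg (m.elt z.1) ((m.theoryHomEquiv ⟨D, z.1⟩ s).apply_symm_apply z.2)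

lemma dir_id (s : m.Theory) :
    m.dir s ⟨op s, 𝟙 _⟩ = ⟨s.1, m.coclosureComonad.idDir s.2⟩ := by
  rw [idDir_eq]
  exact congrArg (fun x => (⟨s.1, m.elt s.2 x⟩ :
    Σ D : c, (m.obj (m.obj (m.familial.ar s.2))).obj D)) (Category.comp_id _)

/-- The map on the right is the label that the comultiplication of `L` attaches to the direction
`f`. It collapses to `m` applied to `f`, which acts on elements by composing labels with `f`. -/
lemma dir_comp (s : m.Theory) (f : Out (op s)) (g : Out f.1) :
    m.dir s ⟨g.1, f.2 ≫ g.2⟩ = ⟨(m.dir f.1.unop g).1,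
      (m.map (m.map (m.η.app _ ≫ under f.2.unop)) ≫ m.map (m.μ.app _)).app _
        (m.dir f.1.unop g).2⟩ := by
  refine congrArg (Sigma.mk g.1.unop.1) ?_
  have h : m.map (m.map (m.η.app _ ≫ under f.2.unop)) ≫ m.map (m.μ.app _) =
      m.map (under f.2.unop) := by
    rw [← m.map_comp, map_unit_under]
  refine Eq.trans ?_ (congrArg (fun t => t.app g.1.unop.1 (m.dir f.1.unop g).2) h.symm)
  refine Eq.trans ?_ (m.map_elt _ _ _).symm
  exact congrArg (m.elt g.1.unop.2) (Category.assoc _ _ _).symm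

/-- The comparison of polynomials from the carrier of the coclosure to `Θ_mᵒᵖ`. -/
def toTheoryPoly :
    polyFunctor m.coclosure.carrier ⟶ polyFunctor (PolyComonoid.ofCat m.Theoryᵒᵖ).carrier where
  app S := ↾fun (z : (polyFunctor m.coclosure.carrier).obj S) =>
    (⟨op (show m.Theory from z.1), fun f => z.2 (m.dir z.1 f)⟩ : Σ x : m.Theoryᵒᵖ, Out x → S)

/-- The comparison homomorphism from the carrier comonoid of the coclosure to `Θ_mᵒᵖ`. -/
noncomputable def toTheory :
    m.coclosureComonad.comonoid ⟶ PolyComonoid.ofCat m.Theoryᵒᵖ where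
  hom := m.toTheoryPoly
  hom_counit S := by
    refine type_hom_ext fun (z : (polyFunctor m.coclosure.carrier).obj S) => ?_
    exact congrArg z.2 (m.dir_id z.1)
  hom_comult S := by
    refine type_hom_ext fun
      (z : Σ s : m.Theory, (Σ D : c, (m.obj (m.obj (m.familial.ar s.2))).obj D) → S) => ?_
    obtain ⟨s, k⟩ := z
    -- The second layer of the comultiplication at the direction `d`, as given by `split_eq`; at
    -- `dir f` its operation is the codomain of `f`.
    let w (d : Σ D : c, (m.obj (m.obj (m.familial.ar s.2))).obj D) :=
      (m.coclosureUnit.app (m.obj (m.familial.ar s.2)) ≫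
        m.coclosure.functor.map (m.map (m.μ.app (m.familial.ar s.2)))).app d.1 d.2
    have h1 : m.coclosureComonad.comonoid.comult.app S (⟨s, k⟩ :
        (polyFunctor m.coclosure.carrier).obj S) =
        ⟨s, fun d => m.coclosure.eval k ⟨d.1, w d⟩⟩ :=
      congrArg (fun t => m.coclosure.eval (m.coclosure.eval k) ⟨s.1, t⟩) (m.split_eq s.2)
    have h2 : ∀ f : Out (op s), w (m.dir s f) = ⟨f.1.unop.2,
        m.map (m.map (m.η.app _ ≫ under f.2.unop)) ≫ m.map (m.μ.app _)⟩ := fun f =>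
      congrArg ((m.coclosure.functor.map (m.map (m.μ.app (m.familial.ar s.2)))).app f.1.unop.1)
        (m.coclosureUnit_elt _ _)
    change (⟨op s, fun f => ⟨f.1, fun g => k (m.dir s ⟨g.1, f.2 ≫ g.2⟩)⟩⟩ :
        Σ x : m.Theoryᵒᵖ, Out x → Σ y : m.Theoryᵒᵖ, Out y → S) = _
    refine Eq.trans ?_ (congrArg (fun t => (polyFunctor (PolyComonoid.ofCat m.Theoryᵒᵖ).carrier).map
      (m.toTheoryPoly.app S) (m.toTheoryPoly.app _ t)) h1.symm)
    refine congrArg (Sigma.mk (op s)) (funext fun f : Out (op s) => ?_)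
    refine Eq.trans ?_ (congrArg (fun t => m.toTheoryPoly.app S
      (m.coclosure.eval k ⟨f.1.unop.1, t⟩)) (h2 f).symm)
    exact congrArg (Sigma.mk f.1) (funext fun g => congrArg k (m.dir_comp s f g))

instance : IsIso m.toTheory.hom := by
  -- Positions are unchanged and labels are precomposed with the bijection `dir`, so each component
  -- is bijective.
  refine @NatIso.isIso_of_isIso_app _ _ _ _ _ _ m.toTheoryPoly fun S =>
    (isIso_iff_bijective _).2 ⟨?_, ?_⟩
  · intro (z : Σ s : m.Theory, (Σ D : c, (m.obj (m.obj (m.familial.ar s.2))).obj D) → S)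
      (z' : Σ s : m.Theory, (Σ D : c, (m.obj (m.obj (m.familial.ar s.2))).obj D) → S)
      (h : (⟨op z.1, fun f => z.2 (m.dir z.1 f)⟩ : Σ x : m.Theoryᵒᵖ, Out x → S) =
        ⟨op z'.1, fun f => z'.2 (m.dir z'.1 f)⟩)
    obtain ⟨s, k⟩ := z
    obtain ⟨s', k'⟩ := z'
    obtain rfl : s = s' := congrArg (fun t => t.1.unop) h
    exact congrArg (Sigma.mk s) ((m.dir_bijective s).2.injective_comp_right
      (eq_of_heq (Sigma.mk.inj h).2))
  · intro (z : Σ x : m.Theoryᵒᵖ, Out x → S)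
    refine ⟨⟨z.1.unop, fun d => z.2 ((Equiv.ofBijective _ (m.dir_bijective z.1.unop)).symm d)⟩, ?_⟩
    exact congrArg (Sigma.mk z.1) (funext fun f =>
      congrArg z.2 ((Equiv.ofBijective _ (m.dir_bijective z.1.unop)).symm_apply_apply f))

/-- Translating the identity direction along `g` labels `g_* M` by the restriction followed by `η`;
the lift of `g`, restricted to generators, is `η` followed by `m` of the restriction. Naturality of
`η` identifies them. -/
lemma toTheory_proj : m.toTheory ≫ m.theoryCofunctor.toHom = m.coclosureComonad.proj := by
  refine PolyComonoid.Hom.ext (poly_hom_ext fun s => ?_)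
  refine congrArg (Sigma.mk s.1) (funext fun g : Out s.1 => ?_)
  refine congrArg (Sigma.mk g.1) ?_
  refine Eq.trans ?_ (congrArg ((m.obj (m.obj (m.familial.ar s.2))).map g.2)
    (m.idDir_eq s.2)).symm
  refine Eq.trans ?_ (m.elt_map _ _ _).symm
  exact congrArg (m.elt (m.familial.ops.map g.2 s.2)) (m.η.naturality (m.familial.res g.2 s.2)).symm

/-! ### Compatible transformations -/

variable {m} in
-- For `α = u ≫ β`, sliding both copies of `β` to the end by naturality leaves the composite that
-- defines the comultiplication of `L`.
lemma unit_comp_comult (A : FamilialComonad c) (β : m.coclosure.functor ⟶ A.functor)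
    (X : c ⥤ Type u) :
    (m.coclosureUnit.app X ≫ β.app (m.obj (m.obj X))) ≫
        A.functor.map (m.coclosureUnit.app (m.obj X) ≫ β.app (m.obj (m.obj (m.obj X)))) ≫
          A.functor.map (A.functor.map (m.map (m.μ.app X))) =
      m.coclosureUnit.app X ≫ m.coclosureComult.app (m.obj (m.obj X)) ≫
        β.app (m.coclosure.functor.obj (m.obj (m.obj X))) ≫
          A.functor.map (β.app (m.obj (m.obj X))) := by
  have h := m.coclosureUnit_comult X
  rw [reassoc_of% h]
  simp only [Category.assoc, NatTrans.naturality_assoc]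
  simp only [← Functor.map_comp, Category.assoc]
  rw [β.naturality]

/-- Transformations out of `L` are determined by their composites with `u`, so the comonad
homomorphism laws for `β` may be tested after `u`, where they are the compatibility laws. -/
lemma compatible_iff (A : FamilialComonad c) (β : m.coclosure.functor ⟶ A.functor) :
    m.Compatible A (m.coclosureUnit ≫ Functor.whiskerLeft (m.toFunctor ⋙ m.toFunctor) β) ↔
      FamilialComonad.IsHom m.coclosureComonad A β := by
  constructor
  · intro h
    refine ⟨fun X => ?_, fun X => ?_⟩
    · have h1 : β ≫ A.counit = m.coclosureCounit := m.coclosure_hom_ext _ _ fun Y =>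
        ((Category.assoc _ _ _).symm.trans (h.counit Y)).trans (m.coclosureUnit_counit Y).symm
      exact NatTrans.congr_app h1 X
    · let γ : m.coclosure.functor ⟶ A.functor ⋙ A.functor :=
        m.coclosureComult ≫ Functor.whiskerLeft m.coclosure.functor β ≫
          Functor.whiskerRight β A.functor
      have h1 : β ≫ A.comult = γ := m.coclosure_hom_ext _ _ fun Y =>
        ((Category.assoc _ _ _).symm.trans (h.comult Y)).trans (unit_comp_comult A β Y)
      exact NatTrans.congr_app h1 X
  · intro h
    refine ⟨fun X => ?_, fun X => ?_⟩
    · exact ((Category.assoc _ _ _).trans (congrArg (m.coclosureUnit.app X ≫ ·)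
        (h.counit (m.obj (m.obj X))))).trans (m.coclosureUnit_counit X)
    · exact ((Category.assoc _ _ _).trans (congrArg (m.coclosureUnit.app X ≫ ·)
        (h.comult (m.obj (m.obj X))))).trans (unit_comp_comult A β X).symm

/-- Cofunctors `Θ_mᵒᵖ ⟶ a` over `c` are the homomorphisms over `c` between the carrier comonoids
of the coclosure and of `a`. -/
noncomputable def cofunctorEquiv {a : Type u} [SmallCategory a] (φ : Cofunctor a c) :
    {F : Cofunctor m.Theoryᵒᵖ a // F.toHom ≫ φ.toHom = m.theoryCofunctor.toHom} ≃
      {h : m.coclosureComonad.comonoid ⟶ φ.comonad.comonoid //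
        h ≫ φ.comonad.proj = m.coclosureComonad.proj} :=
  Equiv.subtypeEquiv (Cofunctor.equivHom.trans
    (Iso.homCongr (PolyComonoid.isoOfIsIso m.toTheory).symm φ.comonoidIso.symm)) fun F => by
      -- Both isomorphisms used for conjugation lie over `c`, so being over `c` is preserved and
      -- reflected.
      rw [← Cofunctor.comonoidIso_hom_toHom, ← toTheory_proj,
        ← cancel_epi (PolyComonoid.isoOfIsIso m.toTheory).hom]
      simp [Cofunctor.equivHom, PolyComonoid.isoOfIsIso]

/-- Cofunctors `Θ_mᵒᵖ ⟶ a` over `c` are the compatible transformations `m ⟶ a ◁ m ◁ m`. -/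
noncomputable def compatibleEquiv {a : Type u} [SmallCategory a] (φ : Cofunctor a c) :
    {F : Cofunctor m.Theoryᵒᵖ a // F.toHom ≫ φ.toHom = m.theoryCofunctor.toHom} ≃
      {α : m.toFunctor ⟶ (m.toFunctor ⋙ m.toFunctor) ⋙ φ.comonad.functor //
        m.Compatible φ.comonad α} :=
  (m.cofunctorEquiv φ).trans ((FamilialComonad.homEquiv m.coclosureComonad φ.comonad).symm.trans
    (Equiv.subtypeEquiv (m.coclosure.functor.homEquivOfIsLeftKanExtension m.coclosureUnit
      φ.comonad.functor) fun β => (m.compatible_iff φ.comonad β).symm))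

end FamilialMonad

end CatSharp

theorem mainTheorem1 {c : Type u} [SmallCategory c] (m : CatSharp.FamilialMonad c) :
    -- `[m / m ◁ m]` is the right coclosure (left Kan extension) of `m` along `m ◁ m`
    m.coclosure.functor.IsLeftKanExtension m.coclosureUnit ∧
    -- its carrier comonoid is the comonoid of `Θ_mᵒᵖ`, identically on objects and over `c`
    ∃ e : m.coclosureComonad.comonoid ≅ CatSharp.PolyComonoid.ofCat m.Theoryᵒᵖ,
      (∀ (S : Type u)
        (z : (CatSharp.polyFunctor m.coclosureComonad.comonoid.carrier).obj S),
        (e.hom.hom.app S z).1 = op z.1) ∧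
      e.hom ≫ m.theoryCofunctor.toHom = m.coclosureComonad.proj ∧
      -- cofunctors `Θ_mᵒᵖ ⟶ a` over `c` correspond to compatible transformations
      -- `m ⟶ a ◁ m ◁ m`
      ∀ (a : Type u) [SmallCategory a] (φ : CatSharp.Cofunctor a c),
        ∃ Φ : {F : CatSharp.Cofunctor m.Theoryᵒᵖ a //
              F.toHom ≫ φ.toHom = m.theoryCofunctor.toHom} ≃
            {α : m.toFunctor ⟶ (m.toFunctor ⋙ m.toFunctor) ⋙ φ.comonad.functor //
              m.Compatible φ.comonad α},
          -- `Φ F` factors through the universal transformation via the transformation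
          -- `[m / m ◁ m] ⟶ a` of bicomodules whose underlying morphism of polynomials is `F`
          ∀ F, ∃ β : m.coclosure.functor ⟶ φ.comonad.functor,
            m.coclosureUnit ≫ Functor.whiskerLeft (m.toFunctor ⋙ m.toFunctor) β = (Φ F).1 ∧
            CatSharp.Familial.carrierMap β ≫ φ.comonoidIso.hom.hom =
              e.hom.hom ≫ F.1.toHom.hom := by
  refine ⟨m.isLeftKanExtension_coclosure, CatSharp.PolyComonoid.isoOfIsIso m.toTheory,
    fun _ _ => rfl, m.toTheory_proj, fun a _ φ => ⟨m.compatibleEquiv φ, fun F => ?_⟩⟩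
  let h := m.cofunctorEquiv φ F
  let β := (CatSharp.FamilialComonad.homEquiv m.coclosureComonad φ.comonad).symm h
  -- The bijection was built by composing with `u` exactly this `β`, so the factorization is
  -- definitional; the remaining identity undoes the conjugation by the two isomorphisms.
  refine ⟨β.1, rfl, ?_⟩
  have h1 : CatSharp.Familial.carrierMap β.1 = h.1.hom :=
    congrArg (fun t => t.1.hom)
      ((CatSharp.FamilialComonad.homEquiv m.coclosureComonad φ.comonad).apply_symm_apply h)
  have h2 : h.1 ≫ φ.comonoidIso.hom = m.toTheory ≫ F.1.toHom :=
    (Category.assoc _ _ _).trans (congrArg (m.toTheory ≫ ·)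
      ((Category.assoc _ _ _).trans ((congrArg (F.1.toHom ≫ ·) φ.comonoidIso.inv_hom_id).trans
        (Category.comp_id _))))
  exact (congrArg (· ≫ φ.comonoidIso.hom.hom) h1).trans
    (congrArg CatSharp.PolyComonoid.Hom.hom h2)
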